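/- Let $b>0$ and $P_x>0$, let $F(r)=1-r^{-3}-br^{-4}$, let $r_s$ be the largest positive root of $F$, and let $P_y=\dfrac{4\pi}{r_s^2F'(r_s)}$. Let $T^2=\mathbb R^2/(P_x\mathbb Z\times P_y\mathbb Z)$ with coordinates $(x,y)$, and equip $M=(r_s,\infty)\times T^2$ (the AdS-Melvin space without its core circle $r=r_s$) with the metric $$\bar g=r^{-2}F(r)^{-1}\,dr^2+r^2\,dx^2+r^2F(r)\,dy^2 .$$ For a surface $\Sigma=\{r=s(x,y)\}\subset M$ that is the graph of a smooth function $s:T^2\to(r_s,\infty)$, let $\nu$ be its outward unit normal (the one pointing towards increasing $r$), $H$ its mean curvature with respect to $\nu$ (the trace of $h(X,Y)=\bar g(\bar\nabla_X\nu,Y)$), $dA$ its area form, $\Omega=\{r_s<r<s(x,y)\}$ the region enclosed by $\Sigma$, $dV$ the volume form of $\bar g$, and $$Q(\Sigma)=\int_\Sigma H\,r\,dA-6\int_\Omega r\,dV .$$ Proposition 5.1. Let $\varphi:[0,\infty)\times T^2\to M$ be a smooth map such that for every $t\ge 0$ the map $\varphi(t,\cdot)$ is an embedding whose image $\Sigma_t$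 is the graph of a smooth function $T^2\to(r_s,\infty)$, and such that $$\frac{\partial\varphi}{\partial t}=r^{-1}\nu\qquad\text{on }[0,\infty)\times T^2,$$ where $r$ and $\nu$ are evaluated at the point $\varphi(t,\cdot)$ of $\Sigma_t$. Then $$\lim_{t\to\infty}Q(\Sigma_t)=P_xP_y\left(2r_s^3-\tfrac12\right).$$ -/

import Mathlib

open Filter Topology Set
open scoped ContDiff Matrix

namespace AdSMelvin

noncomputable section

/-! ### The AdS-Melvin space

Points of `M` off its core circle are written in the coordinates `p = (r, x, y)`, i.e. `p 0 = r`,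
`p 1 = x`, `p 2 = y`, with `r > r_s`, `x` taken modulo `P_x` and `y` taken modulo `P_y`. -/

/-- `F(r) = 1 - r⁻³ - b r⁻⁴`. -/
def F (b r : ℝ) : ℝ := 1 - (r ^ 3)⁻¹ - b * (r ^ 4)⁻¹

/-- The largest positive root `r_s` of `F`. -/
def rs (b : ℝ) : ℝ := sSup {r : ℝ | 0 < r ∧ F b r = 0}

/-- The supremum defining `r_s` is attained: `r_s` is a positive root of `F`, and the largest. -/
theorem rs_isGreatest {b : ℝ} (hb : 0 < b) : IsGreatest {r : ℝ | 0 < r ∧ F b r = 0} (rs b) := by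
  have hF : ∀ r : ℝ, 0 < r → (F b r = 0 ↔ r ^ 4 - r - b = 0) := by
    intro r hr
    have h : F b r = (r ^ 4 - r - b) / r ^ 4 := by
      unfold F
      field_simp
    rw [h, div_eq_zero_iff]
    have : r ^ 4 ≠ 0 := by positivity
    tauto
  have hcont : Continuous fun r : ℝ => r ^ 4 - r - b := by fun_prop
  have hbd : BddAbove {r : ℝ | 0 < r ∧ F b r = 0} := by
    refine ⟨1 + b, ?_⟩
    rintro r ⟨hr, h0⟩
    rw [hF r hr] at h0
    by_contra! hlt
    have h1 : 1 < r := by linarith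
    have h2 : r < r ^ 2 := by nlinarith
    have h3 : r ^ 2 + r ^ 2 * (r - 1) < r ^ 4 := by nlinarith [sq_nonneg (r ^ 2 - r)]
    nlinarith
  have hne : {r : ℝ | 0 < r ∧ F b r = 0}.Nonempty := by
    have h := intermediate_value_Icc (a := (1 : ℝ)) (b := 1 + b) (by linarith)
      hcont.continuousOn
    have hmem : (0 : ℝ) ∈ Icc ((1 : ℝ) ^ 4 - 1 - b) ((1 + b) ^ 4 - (1 + b) - b) := by
      constructor
      · linarith
      · nlinarith [pow_pos hb 2, pow_pos hb 3, pow_pos hb 4]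
    obtain ⟨r, hr, h0⟩ := h hmem
    have hr0 : 0 < r := by linarith [hr.1]
    exact ⟨r, hr0, (hF r hr0).2 h0⟩
  have hcl : sSup {r : ℝ | 0 < r ∧ F b r = 0} ∈ closure {r : ℝ | 0 < r ∧ F b r = 0} :=
    csSup_mem_closure hne hbd
  have hsub : {r : ℝ | 0 < r ∧ F b r = 0} ⊆ {r : ℝ | 0 ≤ r ∧ r ^ 4 - r - b = 0} :=
    fun r hr => ⟨hr.1.le, (hF r hr.1).1 hr.2⟩
  have hclosed : IsClosed {r : ℝ | 0 ≤ r ∧ r ^ 4 - r - b = 0} :=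
    (isClosed_le continuous_const continuous_id).inter (isClosed_eq hcont continuous_const)
  obtain ⟨h0, h1⟩ := closure_minimal hsub hclosed hcl
  have hpos : 0 < sSup {r : ℝ | 0 < r ∧ F b r = 0} := by
    rcases h0.lt_or_eq with h | h
    · exact h
    · rw [← h] at h1
      norm_num at h1
      linarith
  exact ⟨⟨hpos, (hF _ hpos).2 h1⟩, fun r hr => le_csSup hbd hr⟩

/-- The period `P_y = 4π / (r_s² F'(r_s))`, for which the metric closes up smoothly at `r = r_s`. -/
def Py (b : ℝ) : ℝ := 4 * Real.pi / (rs b ^ 2 * deriv (F b) (rs b))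

/-- The metric `r⁻² F(r)⁻¹ dr² + r² dx² + r² F(r) dy²`. -/
def metric (b : ℝ) (p : Fin 3 → ℝ) : Matrix (Fin 3) (Fin 3) ℝ :=
  Matrix.diagonal ![(p 0 ^ 2)⁻¹ * (F b (p 0))⁻¹, p 0 ^ 2, p 0 ^ 2 * F b (p 0)]

/-- `u` and `v` represent the same point `(x, y)` of the torus `T² = ℝ² / (P_x ℤ × P_y ℤ)`. -/
def TorusEq (b Px : ℝ) (u v : Fin 2 → ℝ) : Prop :=
  ∃ m n : ℤ, v 0 = u 0 + m * Px ∧ v 1 = u 1 + n * Py b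

/-- `p` and `q` represent the same point of `M`. -/
def SpaceEq (b Px : ℝ) (p q : Fin 3 → ℝ) : Prop :=
  q 0 = p 0 ∧ TorusEq b Px ![p 1, p 2] ![q 1, q 2]

/-! ### Riemannian geometry in coordinates

`G` is a metric on (an open part of) `ℝ³`, and `X` is a parametrized surface in `ℝ³`. -/

/-- The partial derivative `∂f / ∂xᵏ` at `p`. -/
def pd {n : ℕ} (k : Fin n) (f : (Fin n → ℝ) → ℝ) (p : Fin n → ℝ) : ℝ :=
  fderiv ℝ f p (Pi.single k 1)

/-- The Christoffel symbol `Γᶜ_{ab}` of the Levi-Civita connection of `G`. -/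
def christoffel (G : (Fin 3 → ℝ) → Matrix (Fin 3) (Fin 3) ℝ) (c a d : Fin 3) (p : Fin 3 → ℝ) : ℝ :=
  1 / 2 * ∑ e, (G p)⁻¹ c e *
    (pd a (fun q => G q e d) p + pd d (fun q => G q e a) p - pd e (fun q => G q a d) p)

/-- The coordinate tangent vector `∂X / ∂uⁱ`. -/
def tangent (X : (Fin 2 → ℝ) → Fin 3 → ℝ) (i : Fin 2) (u : Fin 2 → ℝ) : Fin 3 → ℝ :=
  fun a => pd i (fun w => X w a) u

/-- The induced metric `g_{ij} = G(∂ᵢX, ∂ⱼX)`. -/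
def firstForm (G : (Fin 3 → ℝ) → Matrix (Fin 3) (Fin 3) ℝ) (X : (Fin 2 → ℝ) → Fin 3 → ℝ)
    (u : Fin 2 → ℝ) : Matrix (Fin 2) (Fin 2) ℝ :=
  Matrix.of fun i j => tangent X i u ⬝ᵥ (G (X u) *ᵥ tangent X j u)

/-- The covariant derivative `∇̄_{∂ᵢX} ∂ⱼX` along the surface `X`. -/
def covDeriv (G : (Fin 3 → ℝ) → Matrix (Fin 3) (Fin 3) ℝ) (X : (Fin 2 → ℝ) → Fin 3 → ℝ)
    (i j : Fin 2) (u : Fin 2 → ℝ) : Fin 3 → ℝ :=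
  fun c => pd i (fun w => tangent X j w c) u +
    ∑ a, ∑ d, christoffel G c a d (X u) * tangent X i u a * tangent X j u d

/-- The second fundamental form `h_{ij} = G(∇̄_{∂ᵢX} ν, ∂ⱼX) = -G(ν, ∇̄_{∂ᵢX} ∂ⱼX)` with respect
to the unit normal field `ν`. -/
def secondForm (G : (Fin 3 → ℝ) → Matrix (Fin 3) (Fin 3) ℝ) (X : (Fin 2 → ℝ) → Fin 3 → ℝ)
    (ν : (Fin 3 → ℝ) → Fin 3 → ℝ) (u : Fin 2 → ℝ) : Matrix (Fin 2) (Fin 2) ℝ :=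
  Matrix.of fun i j => -(ν (X u) ⬝ᵥ (G (X u) *ᵥ covDeriv G X i j u))

/-- The mean curvature `H = g^{ij} h_{ij}` with respect to the unit normal field `ν`. -/
def meanCurvature (G : (Fin 3 → ℝ) → Matrix (Fin 3) (Fin 3) ℝ) (X : (Fin 2 → ℝ) → Fin 3 → ℝ)
    (ν : (Fin 3 → ℝ) → Fin 3 → ℝ) (u : Fin 2 → ℝ) : ℝ :=
  ∑ i, ∑ j, (firstForm G X u)⁻¹ i j * secondForm G X ν u i j

/-- The normalized gradient `∇̄f / |∇̄f|`, i.e. the unit normal of the level sets of `f` which points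
towards increasing `f`. -/
def unitGradient (G : (Fin 3 → ℝ) → Matrix (Fin 3) (Fin 3) ℝ) (f : (Fin 3 → ℝ) → ℝ)
    (p : Fin 3 → ℝ) : Fin 3 → ℝ :=
  (√((fun a => pd a f p) ⬝ᵥ ((G p)⁻¹ *ᵥ fun a => pd a f p)))⁻¹ • ((G p)⁻¹ *ᵥ fun a => pd a f p)

/-! ### Graphs over the torus and the quantity `Q` -/

/-- `s` is (the lift to `ℝ²` of) a smooth function on `T²` with values in `(r_s, ∞)`. -/
structure IsHeightFunction (b Px : ℝ) (s : (Fin 2 → ℝ) → ℝ) : Prop where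
  smooth : ContDiff ℝ ∞ s
  periodic : ∀ u v, TorusEq b Px u v → s u = s v
  gt_rs : ∀ u, rs b < s u

/-- The parametrization `(x, y) ↦ (s(x, y), x, y)` of the graph of `s`. -/
def graphMap (s : (Fin 2 → ℝ) → ℝ) (u : Fin 2 → ℝ) : Fin 3 → ℝ := ![s u, u 0, u 1]

/-- The outward unit normal `ν` of the graph `Σ = {r = s(x, y)}`: the enclosed region is
`Ω = {r < s(x, y)}`, so on `Σ` the outward normal is the unit gradient of `r - s(x, y)`. -/
def outwardNormal (b : ℝ) (s : (Fin 2 → ℝ) → ℝ) : (Fin 3 → ℝ) → Fin 3 → ℝ :=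
  unitGradient (metric b) fun p => p 0 - s ![p 1, p 2]

/-- `Q(Σ) = ∫_Σ H r dA - 6 ∫_Ω r dV` for the graph `Σ` of `s`, where `dA = √(det g) dx dy` and
`dV = √(det ḡ) dr dx dy`. -/
def Q (b Px : ℝ) (s : (Fin 2 → ℝ) → ℝ) : ℝ :=
  (∫ x in (0)..Px, ∫ y in (0)..Py b,
      meanCurvature (metric b) (graphMap s) (outwardNormal b s) ![x, y] * s ![x, y] *
        √(firstForm (metric b) (graphMap s) ![x, y]).det) -
    6 * ∫ x in (0)..Px, ∫ y in (0)..Py b, ∫ r in (rs b)..(s ![x, y]),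
      r * √(metric b ![r, x, y]).det

/-! ### The flow -/

/-- `X` is the lift to universal covers of a smooth embedding of `T²` into `M` (off the core circle)
with image the graph of `s`. Since `T²` is compact, an injective immersion is an embedding. -/
structure EmbedsOnto (b Px : ℝ) (X : (Fin 2 → ℝ) → Fin 3 → ℝ) (s : (Fin 2 → ℝ) → ℝ) :
    Prop where
  descends : ∀ u v, TorusEq b Px u v → SpaceEq b Px (X u) (X v)
  injective : ∀ u v, SpaceEq b Px (X u) (X v) → TorusEq b Px u v
  immersion : ∀ u, LinearIndependent ℝ fun i => tangent X i u
  image_eq : ∀ p, (∃ u, SpaceEq b Px (X u) p) ↔ p 0 = s ![p 1, p 2]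

/-- `φ : [0, ∞) × T² → M` (lifted to universal covers) is a smooth family of embeddings whose images
`Σ_t` are the graphs of the height functions `s t`, and which solves `∂φ/∂t = r⁻¹ ν`, with `ν` the
outward unit normal of `Σ_t`. (At `t = 0` the derivative is the one-sided one.) -/
structure IsNormalFlow (b Px : ℝ) (φ : ℝ → (Fin 2 → ℝ) → Fin 3 → ℝ)
    (s : ℝ → (Fin 2 → ℝ) → ℝ) : Prop where
  smooth : ContDiffOn ℝ ∞ (fun q : ℝ × (Fin 2 → ℝ) => φ q.1 q.2) (Ici 0 ×ˢ univ)
  height : ∀ t, 0 ≤ t → IsHeightFunction b Px (s t)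
  embeds : ∀ t, 0 ≤ t → EmbedsOnto b Px (φ t) (s t)
  evolves : ∀ t, 0 ≤ t → ∀ u, HasDerivWithinAt (fun τ => φ τ u)
    ((φ t u 0)⁻¹ • outwardNormal b (s t) (φ t u)) (Ici 0) t

end

end AdSMelvin

/-! For a graph `r = s(x, y)` everything can be computed explicitly. Since `√det ḡ = r`, the bulk
term is `6 ∫ r dV = 2 ∫ (s³ - r_s³) dx dy`. On the other side `H r dA` equals `2 s³ - 1/2`, minus
the divergence terms `∂ₓ(sₓ) + ∂_y(s_y / F)`, plus a remainder. The cubic terms cancel, divergences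
integrate to zero over the torus, and `Q = P_x P_y (2 r_s³ - 1/2) + ∫ remainder`
(`meanCurvature_graph`, `Q_eq`). The remainder consists of terms quadratic in the slope with
coefficients `O(1/s)`, and of `(sₓ ∂ₓτ + s_y ∂_yτ / F) / (2 (1 + τ))`, where the tilt `τ` depends on
first derivatives of `s` only. It remains to show that its integral tends to zero.

Speed `r⁻¹` in `ḡ` is unit normal speed in the conformal metric `r² ḡ = F⁻¹ dr² + r⁴ dx² + r⁴ F
dy²`. The flow therefore moves points along unit-speed geodesics of that metric, and the momenta
`α`, `γ` belonging to the Killing fields `∂ₓ`, `∂_y` are constant in time (`conserved`).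
Conservation makes `∂R/∂t` nondecreasing, so `r` grows at least linearly, and it bounds the slopes
through `sₓ = -α/ρ`, `s_y = -γ/ρ` (`exists_flowBounds`). The spatial derivatives of the flow satisfy
a linear system with coefficients integrable in time, hence stay bounded (`exists_jacobian_bound`).

In Lagrangian coordinates `1 + τ = 1/(F ρ²)`, whose spatial derivatives are `O(1/r)`
(`exists_tilt_bound`). Passing back to the torus, the Jacobian of the change of variables turns `∇τ`
into a cofactor combination of Lagrangian derivatives. This bounds `∫ |∇τ|` without any lower bound
on the Jacobian and without second derivative estimates for `s` (`integral_abs_pd_tilt_le`).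
Altogether the error is `O(1/t)`. -/

namespace AdSMelvin

noncomputable section

/-! ### The function F and derivatives along lines -/

/-- `F'(r) = (4 r³ (1 - F(r)) - 1) / r⁴`. -/
theorem hasDerivAt_F (b : ℝ) {r : ℝ} (hr : r ≠ 0) :
    HasDerivAt (F b) ((4 * r ^ 3 * (1 - F b r) - 1) / r ^ 4) r := by
  have h3 := (hasDerivAt_pow 3 r).inv (pow_ne_zero 3 hr)
  have h4 := ((hasDerivAt_pow 4 r).inv (pow_ne_zero 4 hr)).const_mul b
  have h := ((hasDerivAt_const r (1 : ℝ)).sub h3).sub h4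
  refine h.congr_deriv ?_
  unfold F
  simp
  field_simp
  ring

/-- Both `-r⁻³` and `-b r⁻⁴` increase strictly with `r`, and `F` vanishes at `r_s`. -/
theorem F_pos {b : ℝ} (hb : 0 < b) {r : ℝ} (hr : rs b < r) : 0 < F b r := by
  have h := rs_isGreatest hb
  have h0 : 0 < rs b := h.1.1
  have h1 : F b (rs b) = 0 := h.1.2
  have h3 : (r ^ 3)⁻¹ < (rs b ^ 3)⁻¹ :=
    inv_strictAnti₀ (by positivity) (pow_lt_pow_left₀ hr h0.le (by norm_num))
  have h4 : (r ^ 4)⁻¹ < (rs b ^ 4)⁻¹ :=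
    inv_strictAnti₀ (by positivity) (pow_lt_pow_left₀ hr h0.le (by norm_num))
  unfold F at h1 ⊢
  nlinarith

theorem hasDerivAt_line {E : Type*} [NormedAddCommGroup E] [NormedSpace ℝ E] {f : E → ℝ} {z : E}
    (hf : DifferentiableAt ℝ f z) (v : E) :
    HasDerivAt (fun τ : ℝ => f (z + τ • v)) (fderiv ℝ f z v) 0 := by
  have h1 : HasDerivAt (fun τ : ℝ => z + τ • v) v 0 := by
    simpa using ((hasDerivAt_id (0 : ℝ)).smul_const v).const_add z
  have h2 : HasFDerivAt f (fderiv ℝ f z) (z + (0 : ℝ) • v) := by simpa using hf.hasFDerivAt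
  exact h2.comp_hasDerivAt 0 h1

/-- Reduces partial derivatives of compound expressions to one-variable calculus along a line, once
differentiability is known. -/
theorem fderiv_eq_of_line {E : Type*} [NormedAddCommGroup E] [NormedSpace ℝ E] {f : E → ℝ} {z : E}
    (hf : DifferentiableAt ℝ f z) {v : E} {d : ℝ}
    (h : HasDerivAt (fun τ : ℝ => f (z + τ • v)) d 0) : fderiv ℝ f z v = d :=
  (hasDerivAt_line hf v).unique h

/-! ### Connection, normal and second derivatives of graphs -/

theorem pd_comp_coord {n : ℕ} [NeZero n] {f : ℝ → ℝ} {f' : ℝ} {p : Fin n → ℝ}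
    (hf : HasDerivAt f f' (p 0)) (k : Fin n) :
    pd k (fun q => f (q 0)) p = if k = 0 then f' else 0 := by
  have h : HasFDerivAt (fun q : Fin n → ℝ => f (q 0))
      (f' • ContinuousLinearMap.proj (R := ℝ) (φ := fun _ => ℝ) 0) p :=
    hf.comp_hasFDerivAt p (ContinuousLinearMap.proj (R := ℝ) (φ := fun _ => ℝ) 0).hasFDerivAt
  rw [pd, h.fderiv]
  by_cases hk : k = 0
  · subst hk; simp
  · simp [hk, Ne.symm hk]

/-- The Christoffel symbols of a diagonal metric whose coefficients depend on `p 0` only. -/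
theorem christoffel_diagonal {g : Fin 3 → ℝ → ℝ} {g' : Fin 3 → ℝ} {p : Fin 3 → ℝ}
    (hg : ∀ e, HasDerivAt (g e) (g' e) (p 0)) (h0 : ∀ e, g e (p 0) ≠ 0) (c a d : Fin 3) :
    christoffel (fun q => Matrix.diagonal fun e => g e (q 0)) c a d p =
      1 / 2 * (g c (p 0))⁻¹ * ((if a = 0 ∧ c = d then g' c else 0) +
        (if d = 0 ∧ c = a then g' c else 0) - if c = 0 ∧ a = d then g' a else 0) := by
  have hinv : (Matrix.diagonal fun e => g e (p 0))⁻¹ = Matrix.diagonal fun e => (g e (p 0))⁻¹ := by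
    apply Matrix.inv_eq_right_inv
    rw [Matrix.diagonal_mul_diagonal, ← Matrix.diagonal_one]
    congr 1
    funext e
    exact mul_inv_cancel₀ (h0 e)
  have hpd : ∀ k i j : Fin 3, pd k (fun q : Fin 3 → ℝ =>
      (Matrix.diagonal fun e => g e (q 0) : Matrix (Fin 3) (Fin 3) ℝ) i j) p =
        if k = 0 ∧ i = j then g' i else 0 := by
    intro k i j
    by_cases hij : i = j
    · subst hij
      simp only [Matrix.diagonal_apply_eq, and_true]
      exact pd_comp_coord (hg i) k
    · simp [hij, pd]
  unfold christoffel
  simp only [hpd]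
  rw [hinv, Finset.sum_eq_single c]
  · rw [Matrix.diagonal_apply_eq]; ring
  · intro e _ he
    rw [Matrix.diagonal_apply_ne _ (Ne.symm he), zero_mul]
  · simp

theorem metric_eq_diagonal (b : ℝ) : metric b = fun q => Matrix.diagonal fun e =>
    (![fun r => (r ^ 2)⁻¹ * (F b r)⁻¹, fun r => r ^ 2, fun r => r ^ 2 * F b r] :
      Fin 3 → ℝ → ℝ) e (q 0) := by
  funext q
  unfold metric
  congr 1
  funext e
  fin_cases e <;> rfl

theorem pd_coord {n : ℕ} (i k : Fin n) (p : Fin n → ℝ) :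
    pd k (fun q => q i) p = if k = i then 1 else 0 := by
  have h : HasFDerivAt (fun q : Fin n → ℝ => q i)
      (ContinuousLinearMap.proj (R := ℝ) (φ := fun _ => ℝ) i) p :=
    (ContinuousLinearMap.proj (R := ℝ) (φ := fun _ => ℝ) i).hasFDerivAt
  rw [pd, h.fderiv]
  by_cases hk : k = i
  · subst hk; simp
  · simp [hk, Ne.symm hk]

theorem tangent_graphMap (s : (Fin 2 → ℝ) → ℝ) (i : Fin 2) (u : Fin 2 → ℝ) :
    tangent (graphMap s) i u = ![pd i s u, if i = 0 then 1 else 0, if i = 1 then 1 else 0] := by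
  funext a
  fin_cases a
  · rfl
  · exact pd_coord 0 i u
  · exact pd_coord 1 i u

theorem contDiff_pd {n : ℕ} {s : (Fin n → ℝ) → ℝ} (hs : ContDiff ℝ ∞ s) (k : Fin n) :
    ContDiff ℝ ∞ (pd k s) :=
  (hs.fderiv_right (m := ∞) (by simp)).clm_apply contDiff_const

theorem pd_comm {n : ℕ} {s : (Fin n → ℝ) → ℝ} (hs : ContDiff ℝ ∞ s) (i j : Fin n)
    (u : Fin n → ℝ) : pd i (pd j s) u = pd j (pd i s) u := by
  have hd : DifferentiableAt ℝ (fderiv ℝ s) u :=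
    ((hs.fderiv_right (m := ∞) (by simp)).differentiable (by simp)).differentiableAt
  have key : ∀ i j : Fin n, pd i (pd j s) u =
      fderiv ℝ (fderiv ℝ s) u (Pi.single i 1) (Pi.single j 1) := by
    intro i j
    have h := hd.hasFDerivAt.clm_apply (hasFDerivAt_const (Pi.single j (1 : ℝ)) u)
    have h2 : HasFDerivAt (pd j s) _ u := h
    rw [pd, h2.fderiv]
    simp
  rw [key, key]
  exact (hs.contDiffAt.isSymmSndFDerivAt (by simpa using ENat.LEInfty.out)).eq _ _

/-- The covariant second derivatives of a graph. -/
theorem covDeriv_graphMap {b : ℝ} {s : (Fin 2 → ℝ) → ℝ} {u : Fin 2 → ℝ} (hr : s u ≠ 0)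
    (hF : F b (s u) ≠ 0) (i j : Fin 2) :
    covDeriv (metric b) (graphMap s) i j u =
      ![pd i (pd j s) u + 1 / 2 * (s u ^ 2 * F b (s u)) *
          (-(2 * s u * F b (s u) + s u ^ 2 * ((4 * s u ^ 3 * (1 - F b (s u)) - 1) / s u ^ 4)) /
            (s u ^ 2 * F b (s u)) ^ 2 * pd i s u * pd j s u -
          (if i = 0 ∧ j = 0 then 2 * s u else 0) -
          (if i = 1 ∧ j = 1 then
            2 * s u * F b (s u) + s u ^ 2 * ((4 * s u ^ 3 * (1 - F b (s u)) - 1) / s u ^ 4)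
            else 0)),
        1 / s u * ((if j = 0 then pd i s u else 0) + if i = 0 then pd j s u else 0),
        1 / 2 * (2 * s u * F b (s u) + s u ^ 2 * ((4 * s u ^ 3 * (1 - F b (s u)) - 1) / s u ^ 4)) /
          (s u ^ 2 * F b (s u)) * ((if j = 1 then pd i s u else 0) +
            if i = 1 then pd j s u else 0)] := by
  -- The coefficient of `dr²` is the inverse of that of `dy²`, namely `1/(r² F)`, so all Christoffel
  -- symbols are expressed by `(r² F)' = 2 r F + r² F'`.
  set f := F b (s u) with hf
  set f' := (4 * s u ^ 3 * (1 - f) - 1) / s u ^ 4 with hf'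
  have hF' : HasDerivAt (F b) f' (s u) := hasDerivAt_F b hr
  have h2 : HasDerivAt (fun r : ℝ => r ^ 2) (2 * s u) (s u) := by
    simpa using hasDerivAt_pow 2 (s u)
  have hg2 : HasDerivAt (fun r : ℝ => r ^ 2 * F b r) (2 * s u * f + s u ^ 2 * f') (s u) :=
    h2.mul hF'
  have hg0 : HasDerivAt (fun r : ℝ => (r ^ 2)⁻¹ * (F b r)⁻¹)
      (-(2 * s u * f + s u ^ 2 * f') / (s u ^ 2 * f) ^ 2) (s u) := by
    refine (hg2.inv (mul_ne_zero (pow_ne_zero 2 hr) hF)).congr_of_eventuallyEq ?_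
    filter_upwards with r
    simp [mul_comm]
  have hch := fun c a d => christoffel_diagonal (p := graphMap s u) (c := c) (a := a) (d := d)
    (g := ![fun r => (r ^ 2)⁻¹ * (F b r)⁻¹, fun r => r ^ 2, fun r => r ^ 2 * F b r])
    (g' := ![-(2 * s u * f + s u ^ 2 * f') / (s u ^ 2 * f) ^ 2, 2 * s u,
      2 * s u * f + s u ^ 2 * f'])
    (by intro e; fin_cases e; exacts [hg0, h2, hg2])
    (by
      intro e
      fin_cases e
      · exact mul_ne_zero (inv_ne_zero (pow_ne_zero 2 hr)) (inv_ne_zero hF)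
      · exact pow_ne_zero 2 hr
      · exact mul_ne_zero (pow_ne_zero 2 hr) hF)
  rw [← metric_eq_diagonal] at hch
  have hc : ∀ (k : Fin 2) (x : ℝ), pd k (fun _ : Fin 2 → ℝ => x) u = 0 := by simp [pd]
  have hg : graphMap s u 0 = s u := rfl
  funext c
  unfold covDeriv
  simp only [hch, tangent_graphMap, Fin.sum_univ_three, hg]
  clear_value f'
  fin_cases c <;> fin_cases i <;> fin_cases j <;>
    simp [hc, ← hf] <;> first | (field_simp; done) | (field_simp; ring1) | ring1 | (field_simp; simp)

theorem firstForm_graphMap (b : ℝ) (s : (Fin 2 → ℝ) → ℝ) (u : Fin 2 → ℝ) :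
    firstForm (metric b) (graphMap s) u =
      !![(s u ^ 2)⁻¹ * (F b (s u))⁻¹ * pd 0 s u ^ 2 + s u ^ 2,
          (s u ^ 2)⁻¹ * (F b (s u))⁻¹ * pd 0 s u * pd 1 s u;
        (s u ^ 2)⁻¹ * (F b (s u))⁻¹ * pd 0 s u * pd 1 s u,
          (s u ^ 2)⁻¹ * (F b (s u))⁻¹ * pd 1 s u ^ 2 + s u ^ 2 * F b (s u)] := by
  have hg : graphMap s u 0 = s u := rfl
  ext i j
  simp only [firstForm, tangent_graphMap, metric, hg, Matrix.of_apply]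
  fin_cases i <;> fin_cases j <;>
    simp [dotProduct, Matrix.mulVec_diagonal, Fin.sum_univ_three] <;> ring

/-- The squared length of `d(r - s)` with respect to the metric. -/
def gradSq (b r p q : ℝ) : ℝ := r ^ 2 * F b r + p ^ 2 / r ^ 2 + q ^ 2 / (r ^ 2 * F b r)

theorem outwardNormal_eq {b : ℝ} {s : (Fin 2 → ℝ) → ℝ} (hs : ContDiff ℝ ∞ s) {P : Fin 3 → ℝ}
    (hr : P 0 ≠ 0) (hF : F b (P 0) ≠ 0) :
    outwardNormal b s P = (√(gradSq b (P 0) (pd 0 s ![P 1, P 2]) (pd 1 s ![P 1, P 2])))⁻¹ •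
      ![P 0 ^ 2 * F b (P 0), -(pd 0 s ![P 1, P 2]) / P 0 ^ 2,
        -(pd 1 s ![P 1, P 2]) / (P 0 ^ 2 * F b (P 0))] := by
  have hpd : (fun a => pd a (fun p : Fin 3 → ℝ => p 0 - s ![p 1, p 2]) P) =
      ![1, -(pd 0 s ![P 1, P 2]), -(pd 1 s ![P 1, P 2])] := by
    have hsd : Differentiable ℝ s := hs.differentiable (by simp)
    have hproj : Differentiable ℝ fun p : Fin 3 → ℝ => ![p 1, p 2] := by
      rw [differentiable_pi]
      intro i
      fin_cases i
      · exact differentiable_apply 1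
      · exact differentiable_apply 2
    have hd : DifferentiableAt ℝ (fun p : Fin 3 → ℝ => p 0 - s ![p 1, p 2]) P :=
      ((differentiable_apply 0).sub (hsd.comp hproj)).differentiableAt
    funext a
    -- Each component is read off along a coordinate line: the `r`-line gives 1, the two torus lines
    -- give minus the slopes.
    refine fderiv_eq_of_line hd ?_
    have hl := fun k : Fin 2 => hasDerivAt_line (hsd ![P 1, P 2]) (Pi.single k (1 : ℝ))
    fin_cases a
    · have : HasDerivAt (fun τ : ℝ => P 0 + τ - s ![P 1, P 2]) 1 0 :=
        ((hasDerivAt_id (0 : ℝ)).const_add _).sub_const _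
      simpa using this
    · have := (hl 0).const_sub (P 0)
      refine this.congr_of_eventuallyEq ?_
      filter_upwards with τ
      simp only [Pi.add_apply, Pi.smul_apply, smul_eq_mul]
      congr 2
      · simp
      · funext i; fin_cases i <;> simp
    · have := (hl 1).const_sub (P 0)
      refine this.congr_of_eventuallyEq ?_
      filter_upwards with τ
      simp only [Pi.add_apply, Pi.smul_apply, smul_eq_mul]
      congr 2
      · simp
      · funext i; fin_cases i <;> simp
  have hinv : (metric b P)⁻¹ =
      Matrix.diagonal ![P 0 ^ 2 * F b (P 0), (P 0 ^ 2)⁻¹, (P 0 ^ 2 * F b (P 0))⁻¹] := by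
    apply Matrix.inv_eq_right_inv
    rw [metric, Matrix.diagonal_mul_diagonal, ← Matrix.diagonal_one]
    congr 1
    funext e
    fin_cases e <;> simp <;> field_simp
  have hv : (Matrix.diagonal ![P 0 ^ 2 * F b (P 0), (P 0 ^ 2)⁻¹, (P 0 ^ 2 * F b (P 0))⁻¹]) *ᵥ
      ![1, -(pd 0 s ![P 1, P 2]), -(pd 1 s ![P 1, P 2])] =
      ![P 0 ^ 2 * F b (P 0), -(pd 0 s ![P 1, P 2]) / P 0 ^ 2,
        -(pd 1 s ![P 1, P 2]) / (P 0 ^ 2 * F b (P 0))] := by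
    funext a
    rw [Matrix.mulVec_diagonal]
    fin_cases a <;> simp <;> ring
  unfold outwardNormal unitGradient
  rw [hpd, hinv, hv]
  congr 3
  simp [dotProduct, Fin.sum_univ_three, gradSq]
  ring

/-! ### The tilt and the curvature integrand -/

/-- The ratio `|d_T s|² / |dr|²` of the tangential to the radial part of `|d(r - s)|²`. -/
def tilt (b : ℝ) (s : (Fin 2 → ℝ) → ℝ) (u : Fin 2 → ℝ) : ℝ :=
  pd 0 s u ^ 2 / (s u ^ 4 * F b (s u)) + pd 1 s u ^ 2 / (s u ^ 4 * F b (s u) ^ 2)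

theorem contDiff_F_comp {b : ℝ} {s : (Fin 2 → ℝ) → ℝ} (hs : ContDiff ℝ ∞ s)
    (h0 : ∀ u, s u ≠ 0) : ContDiff ℝ ∞ fun u => F b (s u) := by
  unfold F
  exact (contDiff_const.sub ((hs.pow 3).inv fun u => pow_ne_zero 3 (h0 u))).sub
    (contDiff_const.mul ((hs.pow 4).inv fun u => pow_ne_zero 4 (h0 u)))

theorem contDiff_tilt {b : ℝ} {s : (Fin 2 → ℝ) → ℝ} (hs : ContDiff ℝ ∞ s)
    (h0 : ∀ u, s u ≠ 0) (hF : ∀ u, F b (s u) ≠ 0) : ContDiff ℝ ∞ (tilt b s) := by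
  have h1 := contDiff_F_comp (b := b) hs h0
  exact (((contDiff_pd hs 0).pow 2).div ((hs.pow 4).mul h1)
    fun u => mul_ne_zero (pow_ne_zero 4 (h0 u)) (hF u)).add
    (((contDiff_pd hs 1).pow 2).div ((hs.pow 4).mul (h1.pow 2))
    fun u => mul_ne_zero (pow_ne_zero 4 (h0 u)) (pow_ne_zero 2 (hF u)))

theorem pd_tilt {b : ℝ} {s : (Fin 2 → ℝ) → ℝ} (hs : ContDiff ℝ ∞ s)
    (h0 : ∀ u, s u ≠ 0) (hF : ∀ u, F b (s u) ≠ 0) (k : Fin 2) (u : Fin 2 → ℝ) :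
    pd k (tilt b s) u =
      (2 * pd 0 s u * pd k (pd 0 s) u) / (s u ^ 4 * F b (s u)) +
      (2 * pd 1 s u * pd k (pd 1 s) u) / (s u ^ 4 * F b (s u) ^ 2) -
      pd k s u * (pd 0 s u ^ 2 * (4 * s u ^ 3 - 1) / (s u ^ 4 * F b (s u)) ^ 2 +
        pd 1 s u ^ 2 * (2 * (4 * s u ^ 3 - 1) - 4 * s u ^ 3 * F b (s u)) /
          (s u ^ 8 * F b (s u) ^ 3)) := by
  have hd : Differentiable ℝ (tilt b s) := (contDiff_tilt hs h0 hF).differentiable (by simp)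
  refine fderiv_eq_of_line hd.differentiableAt ?_
  set v : Fin 2 → ℝ := Pi.single k 1 with hv
  have hz : u + (0 : ℝ) • v = u := by simp
  have hsl : HasDerivAt (fun τ : ℝ => s (u + τ • v)) (pd k s u) 0 :=
    hasDerivAt_line (hs.differentiable (by simp)).differentiableAt _
  have hp : ∀ i, HasDerivAt (fun τ : ℝ => pd i s (u + τ • v)) (pd k (pd i s) u) 0 := fun i =>
    hasDerivAt_line ((contDiff_pd hs i).differentiable (by simp)).differentiableAt _
  have hFl : HasDerivAt (fun τ : ℝ => F b (s (u + τ • v)))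
      ((4 * s u ^ 3 * (1 - F b (s u)) - 1) / s u ^ 4 * pd k s u) 0 := by
    have h := hasDerivAt_F b (h0 (u + (0 : ℝ) • v))
    have h2 := h.comp 0 hsl
    rwa [hz] at h2
  have hne := h0 u
  have hFne := hF u
  have h1 := ((hp 0).pow 2).div ((hsl.pow 4).mul hFl)
    (by simpa [hz] using mul_ne_zero (pow_ne_zero 4 (h0 u)) (hF u))
  have h2 := ((hp 1).pow 2).div ((hsl.pow 4).mul (hFl.pow 2))
    (by simpa [hz] using ⟨h0 u, hF u⟩)
  refine (h1.add h2).congr_deriv ?_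
  simp only [Pi.mul_apply, Pi.pow_apply, hz]
  field_simp
  ring

theorem pd_div_F {b : ℝ} {s : (Fin 2 → ℝ) → ℝ} (hs : ContDiff ℝ ∞ s)
    (h0 : ∀ u, s u ≠ 0) (hF : ∀ u, F b (s u) ≠ 0) (k : Fin 2) (u : Fin 2 → ℝ) :
    pd k (fun w => pd 1 s w / F b (s w)) u = pd k (pd 1 s) u / F b (s u) -
      pd 1 s u * ((4 * s u ^ 3 * (1 - F b (s u)) - 1) / s u ^ 4 * pd k s u) / F b (s u) ^ 2 := by
  have hd : Differentiable ℝ (fun w => pd 1 s w / F b (s w)) :=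
    ((contDiff_pd hs 1).div (contDiff_F_comp hs h0) hF).differentiable (by simp)
  refine fderiv_eq_of_line hd.differentiableAt ?_
  set v : Fin 2 → ℝ := Pi.single k 1 with hv
  have hz : u + (0 : ℝ) • v = u := by simp
  have hsl : HasDerivAt (fun τ : ℝ => s (u + τ • v)) (pd k s u) 0 :=
    hasDerivAt_line (hs.differentiable (by simp)).differentiableAt _
  have hp : HasDerivAt (fun τ : ℝ => pd 1 s (u + τ • v)) (pd k (pd 1 s) u) 0 :=
    hasDerivAt_line ((contDiff_pd hs 1).differentiable (by simp)).differentiableAt _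
  have hFl : HasDerivAt (fun τ : ℝ => F b (s (u + τ • v)))
      ((4 * s u ^ 3 * (1 - F b (s u)) - 1) / s u ^ 4 * pd k s u) 0 := by
    have h := hasDerivAt_F b (h0 (u + (0 : ℝ) • v))
    have h2 := h.comp 0 hsl
    rwa [hz] at h2
  have hne := h0 u
  have hFne := hF u
  refine (hp.div hFl (by simpa [hz] using hF u)).congr_deriv ?_
  simp only [hz]
  field_simp

/-- The integrand of `∫ H r dA` over a graph, up to terms of divergence form and terms of lower
order. -/
theorem meanCurvature_graph {b : ℝ} {s : (Fin 2 → ℝ) → ℝ} (hs : ContDiff ℝ ∞ s)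
    (h0 : ∀ u, 0 < s u) (hF : ∀ u, 0 < F b (s u)) (u : Fin 2 → ℝ) :
    meanCurvature (metric b) (graphMap s) (outwardNormal b s) u * s u *
        √(firstForm (metric b) (graphMap s) u).det =
      2 * s u ^ 3 - 1 / 2 - pd 0 (pd 0 s) u - pd 1 (fun w => pd 1 s w / F b (s w)) u +
      (pd 0 s u ^ 2 * (2 / s u + (4 * s u ^ 3 * (1 - F b (s u)) - 1) / s u ^ 4 / (2 * F b (s u))) +
        2 * pd 1 s u ^ 2 / (s u * F b (s u))) +
      (pd 0 s u * pd 0 (tilt b s) u + pd 1 s u / F b (s u) * pd 1 (tilt b s) u) /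
        (2 * (1 + tilt b s u)) := by
  have hr := h0 u
  have hf := hF u
  have hs0 : ∀ u, s u ≠ 0 := fun u => (h0 u).ne'
  have hF0 : ∀ u, F b (s u) ≠ 0 := fun u => (hF u).ne'
  have hr0 := hr.ne'
  have hf0 := hf.ne'
  have hgs : graphMap s u 0 = s u := rfl
  have hgs' : ![graphMap s u 1, graphMap s u 2] = u := by
    funext i; fin_cases i <;> rfl
  have hB : pd 1 (pd 0 s) u = pd 0 (pd 1 s) u := pd_comm hs 1 0 u
  have hnu := outwardNormal_eq (b := b) hs (P := graphMap s u) hr0 hf0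
  rw [hgs, hgs'] at hnu
  have hcov := covDeriv_graphMap (b := b) hr0 hf0
  -- The area density is `s √gradSq`, so the factor `1/√gradSq` of the unit normal cancels and `H r
  -- dA` is a rational expression in the 2-jet of `s`.
  have hdet : (firstForm (metric b) (graphMap s) u).det =
      s u ^ 2 * gradSq b (s u) (pd 0 s u) (pd 1 s u) := by
    rw [firstForm_graphMap, Matrix.det_fin_two_of, gradSq]
    field_simp
    ring
  have hgp : 0 < gradSq b (s u) (pd 0 s u) (pd 1 s u) := by unfold gradSq; positivity
  rw [pd_div_F hs hs0 hF0, pd_tilt hs hs0 hF0, pd_tilt hs hs0 hF0]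
  have hW : ∀ x : ℝ, x * (√(gradSq b (s u) (pd 0 s u) (pd 1 s u)))⁻¹ * s u *
      √(firstForm (metric b) (graphMap s) u).det = x * s u ^ 2 := by
    intro x
    rw [hdet, Real.sqrt_mul (by positivity), Real.sqrt_sq hr.le]
    have := (Real.sqrt_pos.2 hgp).ne'
    field_simp
  have hsec : ∀ i j, secondForm (metric b) (graphMap s) (outwardNormal b s) u i j =
      -(covDeriv (metric b) (graphMap s) i j u 0 - pd 0 s u * covDeriv (metric b) (graphMap s) i j u 1
        - pd 1 s u * covDeriv (metric b) (graphMap s) i j u 2) *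
        (√(gradSq b (s u) (pd 0 s u) (pd 1 s u)))⁻¹ := by
    intro i j
    rw [secondForm, Matrix.of_apply, hnu, metric, hgs]
    generalize covDeriv (metric b) (graphMap s) i j u = c
    simp [dotProduct, Matrix.mulVec_diagonal, Fin.sum_univ_three]
    field_simp
    ring
  rw [meanCurvature]
  simp only [hsec, ← mul_assoc, ← Finset.sum_mul]
  rw [hW]
  have hinv : (firstForm (metric b) (graphMap s) u)⁻¹ =
      (s u ^ 2 * gradSq b (s u) (pd 0 s u) (pd 1 s u))⁻¹ •
      (firstForm (metric b) (graphMap s) u).adjugate := by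
    rw [Matrix.inv_def, hdet, Ring.inverse_eq_inv']
  rw [hinv, firstForm_graphMap, Matrix.adjugate_fin_two_of]
  simp only [hcov, Fin.sum_univ_two]
  unfold tilt
  -- `1 + τ` is the full squared length of `d(r - s)` divided by its radial part `r² F`.
  have hden : (1 + (pd 0 s u ^ 2 / (s u ^ 4 * F b (s u)) +
      pd 1 s u ^ 2 / (s u ^ 4 * F b (s u) ^ 2))) =
      gradSq b (s u) (pd 0 s u) (pd 1 s u) / (s u ^ 2 * F b (s u)) := by
    unfold gradSq; field_simp; ring
  rw [hden]
  have hG : gradSq b (s u) (pd 0 s u) (pd 1 s u) * (s u ^ 2 * F b (s u)) =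
    s u ^ 4 * F b (s u) ^ 2 + pd 0 s u ^ 2 * F b (s u) + pd 1 s u ^ 2 := by
    unfold gradSq; field_simp
  have hgi : gradSq b (s u) (pd 0 s u) (pd 1 s u) =
    (s u ^ 4 * F b (s u) ^ 2 + pd 0 s u ^ 2 * F b (s u) + pd 1 s u ^ 2) / (s u ^ 2 * F b (s u)) := by
    rw [← hG]; field_simp
  rw [hgi]
  have hD : (s u ^ 4 * F b (s u) ^ 2 + pd 0 s u ^ 2 * F b (s u) + pd 1 s u ^ 2) ≠ 0 := by positivity
  simp [hB]
  -- Once the 2-jet of `s` and the value of `F` are treated as independent variables, what remains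
  -- is an identity of rational functions.
  generalize pd 0 s u = p at *
  generalize pd 1 s u = q at *
  generalize pd 0 (pd 0 s) u = A at *
  generalize pd 0 (pd 1 s) u = B at *
  generalize pd 1 (pd 1 s) u = C at *
  generalize F b (s u) = f at *
  generalize s u = r at *
  field_simp
  ring

/-! ### Space-time calculus and the geodesic flow -/

/-- The directional derivative of a function on space-time `ℝ × ℝ²`. -/
def dirD (v : ℝ × (Fin 2 → ℝ)) (f : ℝ × (Fin 2 → ℝ) → ℝ) (z : ℝ × (Fin 2 → ℝ)) : ℝ :=
  fderiv ℝ f z v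

/-- The time direction. -/
def eT : ℝ × (Fin 2 → ℝ) := (1, 0)

/-- The spatial coordinate directions. -/
def eX (i : Fin 2) : ℝ × (Fin 2 → ℝ) := (0, Pi.single i 1)

/-- Positive times. -/
def posTime : Set (ℝ × (Fin 2 → ℝ)) := {z | 0 < z.1}

theorem isOpen_posTime : IsOpen posTime := isOpen_lt continuous_const continuous_fst

theorem contDiffOn_dirD {f : ℝ × (Fin 2 → ℝ) → ℝ} (hf : ContDiffOn ℝ ∞ f posTime)
    (v : ℝ × (Fin 2 → ℝ)) : ContDiffOn ℝ ∞ (dirD v f) posTime :=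
  (hf.fderiv_of_isOpen (m := ∞) isOpen_posTime (by simp)).clm_apply contDiffOn_const

theorem differentiableAt_of_posTime {f : ℝ × (Fin 2 → ℝ) → ℝ} (hf : ContDiffOn ℝ ∞ f posTime)
    {z : ℝ × (Fin 2 → ℝ)} (hz : z ∈ posTime) : DifferentiableAt ℝ f z :=
  (hf.contDiffAt (isOpen_posTime.mem_nhds hz)).differentiableAt (by simp)

theorem dirD_line {f : ℝ × (Fin 2 → ℝ) → ℝ} (hf : ContDiffOn ℝ ∞ f posTime)
    {z : ℝ × (Fin 2 → ℝ)} (hz : z ∈ posTime) (v : ℝ × (Fin 2 → ℝ)) :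
    HasDerivAt (fun τ : ℝ => f (z + τ • v)) (dirD v f z) 0 :=
  hasDerivAt_line (differentiableAt_of_posTime hf hz) v

/-- The flow identities are only available at positive times. That set is open, so a short piece of
the line stays inside it. -/
theorem dirD_eq_of_line {f g : ℝ × (Fin 2 → ℝ) → ℝ} (hf : ContDiffOn ℝ ∞ f posTime)
    (h : ∀ z ∈ posTime, f z = g z) {z : ℝ × (Fin 2 → ℝ)} (hz : z ∈ posTime)
    {v : ℝ × (Fin 2 → ℝ)} {d : ℝ} (hd : HasDerivAt (fun τ : ℝ => g (z + τ • v)) d 0) :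
    dirD v f z = d := by
  have h1 := dirD_line hf hz v
  have hc : Continuous fun τ : ℝ => z + τ • v := by fun_prop
  have hev : ∀ᶠ τ : ℝ in 𝓝 0, z + τ • v ∈ posTime :=
    hc.continuousAt.eventually_mem (isOpen_posTime.mem_nhds (by simpa using hz))
  refine h1.unique (hd.congr_of_eventuallyEq ?_)
  filter_upwards [hev] with τ hτ using h _ hτ

theorem dirD_comm {f : ℝ × (Fin 2 → ℝ) → ℝ} (hf : ContDiffOn ℝ ∞ f posTime)
    {z : ℝ × (Fin 2 → ℝ)} (hz : z ∈ posTime) (v w : ℝ × (Fin 2 → ℝ)) :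
    dirD v (dirD w f) z = dirD w (dirD v f) z := by
  have hc : ContDiffAt ℝ ∞ f z := hf.contDiffAt (isOpen_posTime.mem_nhds hz)
  have hd : DifferentiableAt ℝ (fderiv ℝ f) z :=
    (hc.fderiv_right (m := ∞) (by simp)).differentiableAt (by simp)
  have key : ∀ v w, dirD v (dirD w f) z = fderiv ℝ (fderiv ℝ f) z v w := by
    intro v w
    have h2 : HasFDerivAt (dirD w f) _ z := hd.hasFDerivAt.clm_apply (hasFDerivAt_const w z)
    rw [dirD, h2.fderiv]
    simp
  rw [key, key]
  exact (hc.isSymmSndFDerivAt (by simpa using ENat.LEInfty.out)).eq _ _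

/-- The space-time form of a normal flow in the conformal metric `F⁻¹ dr² + r⁴ dx² + r⁴ F dy²`:
`(ρ, α, γ)` are the covariant components of the velocity. -/
structure LagrangianFlow (b : ℝ) (R X Y ρ α γ : ℝ × (Fin 2 → ℝ) → ℝ) : Prop where
  smoothR : ContDiffOn ℝ ∞ R posTime
  smoothX : ContDiffOn ℝ ∞ X posTime
  smoothY : ContDiffOn ℝ ∞ Y posTime
  smoothρ : ContDiffOn ℝ ∞ ρ posTime
  smoothα : ContDiffOn ℝ ∞ α posTime
  smoothγ : ContDiffOn ℝ ∞ γ posTime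
  R_gt : ∀ z ∈ posTime, rs b < R z
  ρ_pos : ∀ z ∈ posTime, 0 < ρ z
  R_t : ∀ z ∈ posTime, dirD eT R z = F b (R z) * ρ z
  X_t : ∀ z ∈ posTime, dirD eT X z = α z / R z ^ 4
  Y_t : ∀ z ∈ posTime, dirD eT Y z = γ z / (R z ^ 4 * F b (R z))
  unit : ∀ z ∈ posTime, F b (R z) * ρ z ^ 2 + α z ^ 2 / R z ^ 4 +
    γ z ^ 2 / (R z ^ 4 * F b (R z)) = 1
  normal : ∀ i, ∀ z ∈ posTime,
    ρ z * dirD (eX i) R z + α z * dirD (eX i) X z + γ z * dirD (eX i) Y z = 0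
  jacobian : ∀ z ∈ posTime,
    dirD (eX 0) X z * dirD (eX 1) Y z - dirD (eX 1) X z * dirD (eX 0) Y z ≠ 0

/-- The derivative `F'(r)`. -/
def dF (b r : ℝ) : ℝ := (4 * r ^ 3 * (1 - F b r) - 1) / r ^ 4

namespace LagrangianFlow

variable {b : ℝ} {R X Y ρ α γ : ℝ × (Fin 2 → ℝ) → ℝ}

theorem R_pos (hb : 0 < b) (h : LagrangianFlow b R X Y ρ α γ) {z : ℝ × (Fin 2 → ℝ)}
    (hz : z ∈ posTime) : 0 < R z := (rs_isGreatest hb).1.1.trans (h.R_gt z hz)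

theorem F_R_pos (hb : 0 < b) (h : LagrangianFlow b R X Y ρ α γ) {z : ℝ × (Fin 2 → ℝ)}
    (hz : z ∈ posTime) : 0 < F b (R z) := F_pos hb (h.R_gt z hz)

theorem line_F (hb : 0 < b) (h : LagrangianFlow b R X Y ρ α γ) {z : ℝ × (Fin 2 → ℝ)}
    (hz : z ∈ posTime) (v : ℝ × (Fin 2 → ℝ)) :
    HasDerivAt (fun τ : ℝ => F b (R (z + τ • v))) (dF b (R z) * dirD v R z) 0 := by
  have h1 : HasDerivAt (F b) (dF b (R z)) (R (z + (0 : ℝ) • v)) := by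
    simpa [dF] using hasDerivAt_F b (h.R_pos hb hz).ne'
  exact h1.comp 0 (dirD_line h.smoothR hz v)

theorem dirD_R_t (hb : 0 < b) (h : LagrangianFlow b R X Y ρ α γ) {z : ℝ × (Fin 2 → ℝ)}
    (hz : z ∈ posTime) (v : ℝ × (Fin 2 → ℝ)) :
    dirD v (dirD eT R) z = dF b (R z) * dirD v R z * ρ z + F b (R z) * dirD v ρ z := by
  refine dirD_eq_of_line (contDiffOn_dirD h.smoothR _) h.R_t hz
    (((h.line_F hb hz v).mul (dirD_line h.smoothρ hz v)).congr_deriv ?_)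
  simp

theorem dirD_X_t (hb : 0 < b) (h : LagrangianFlow b R X Y ρ α γ) {z : ℝ × (Fin 2 → ℝ)}
    (hz : z ∈ posTime) (v : ℝ × (Fin 2 → ℝ)) :
    dirD v (dirD eT X) z = dirD v α z / R z ^ 4 - 4 * α z * dirD v R z / R z ^ 5 := by
  have hR := (h.R_pos hb hz).ne'
  refine dirD_eq_of_line (contDiffOn_dirD h.smoothX _) h.X_t hz
    (((dirD_line h.smoothα hz v).div ((dirD_line h.smoothR hz v).pow 4)
      (by simpa using hR)).congr_deriv ?_)
  simp
  field_simp

theorem dirD_Y_t (hb : 0 < b) (h : LagrangianFlow b R X Y ρ α γ) {z : ℝ × (Fin 2 → ℝ)}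
    (hz : z ∈ posTime) (v : ℝ × (Fin 2 → ℝ)) :
    dirD v (dirD eT Y) z = dirD v γ z / (R z ^ 4 * F b (R z)) -
      γ z * dirD v R z * (4 / (R z ^ 5 * F b (R z)) + dF b (R z) / (R z ^ 4 * F b (R z) ^ 2)) := by
  have hR := (h.R_pos hb hz).ne'
  have hF := (h.F_R_pos hb hz).ne'
  refine dirD_eq_of_line (contDiffOn_dirD h.smoothY _) h.Y_t hz
    (((dirD_line h.smoothγ hz v).div (((dirD_line h.smoothR hz v).pow 4).mul (h.line_F hb hz v))
      (by simpa using ⟨hR, hF⟩)).congr_deriv ?_)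
  simp
  field_simp

theorem dirD_unit (hb : 0 < b) (h : LagrangianFlow b R X Y ρ α γ) {z : ℝ × (Fin 2 → ℝ)}
    (hz : z ∈ posTime) (v : ℝ × (Fin 2 → ℝ)) :
    dF b (R z) * dirD v R z * ρ z ^ 2 + 2 * F b (R z) * ρ z * dirD v ρ z +
      (2 * α z * dirD v α z / R z ^ 4 - 4 * α z ^ 2 * dirD v R z / R z ^ 5) +
      (2 * γ z * dirD v γ z / (R z ^ 4 * F b (R z)) - γ z ^ 2 * dirD v R z *
        (4 / (R z ^ 5 * F b (R z)) + dF b (R z) / (R z ^ 4 * F b (R z) ^ 2))) = 0 := by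
  have hR := (h.R_pos hb hz).ne'
  have hF := (h.F_R_pos hb hz).ne'
  have hRl := dirD_line h.smoothR hz v
  have hFl := h.line_F hb hz v
  have h1 := ((hFl.mul ((dirD_line h.smoothρ hz v).pow 2)).add
    (((dirD_line h.smoothα hz v).pow 2).div (hRl.pow 4) (by simpa using hR))).add
    (((dirD_line h.smoothγ hz v).pow 2).div ((hRl.pow 4).mul hFl) (by simpa using ⟨hR, hF⟩))
  have h2 : dirD v (fun _ => (1 : ℝ)) z = 0 := by simp [dirD]
  rw [← h2]
  symm
  refine dirD_eq_of_line contDiffOn_const (fun w hw => (h.unit w hw).symm) hz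
    (h1.congr_deriv ?_)
  simp
  field_simp

/-- The velocity is a geodesic field, so its components along the Killing fields `∂ₓ` and `∂_y` are
constant in time. -/
theorem conserved (hb : 0 < b) (h : LagrangianFlow b R X Y ρ α γ) {z : ℝ × (Fin 2 → ℝ)}
    (hz : z ∈ posTime) : dirD eT α z = 0 ∧ dirD eT γ z = 0 := by
  have hR := (h.R_pos hb hz).ne'
  have hF := (h.F_R_pos hb hz).ne'
  -- `k` is the `r`-derivative, at fixed momenta, of twice the Hamiltonian `½ (F ρ² + α²/r⁴ + γ²/(r⁴
  -- F))`. The radial Hamilton equation is `∂ρ/∂t + k/2 = 0`.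
  set k := dF b (R z) * ρ z ^ 2 - 4 * α z ^ 2 / R z ^ 5 - γ z ^ 2 *
    (4 / (R z ^ 5 * F b (R z)) + dF b (R z) / (R z ^ 4 * F b (R z) ^ 2)) with hk
  -- As in the Gauss lemma: differentiate orthogonality to the surface in time, commute derivatives,
  -- and use half the spatial derivative of the unit-length condition.
  have hspace : ∀ i, (dirD eT ρ z + k / 2) * dirD (eX i) R z + dirD eT α z * dirD (eX i) X z +
      dirD eT γ z * dirD (eX i) Y z = 0 := by
    intro i
    have h2 : dirD eT (fun _ => (0 : ℝ)) z = 0 := by simp [dirD]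
    have h3 : dirD eT (fun _ => (0 : ℝ)) z = _ :=
      dirD_eq_of_line contDiffOn_const (fun w hw => (h.normal i w hw).symm) hz
      ((((dirD_line h.smoothρ hz eT).mul
        (dirD_line (contDiffOn_dirD h.smoothR (eX i)) hz eT)).add
        ((dirD_line h.smoothα hz eT).mul
        (dirD_line (contDiffOn_dirD h.smoothX (eX i)) hz eT))).add
        ((dirD_line h.smoothγ hz eT).mul
        (dirD_line (contDiffOn_dirD h.smoothY (eX i)) hz eT)))
    rw [h2, dirD_comm h.smoothR hz, dirD_comm h.smoothX hz, dirD_comm h.smoothY hz,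
      h.dirD_R_t hb hz, h.dirD_X_t hb hz, h.dirD_Y_t hb hz] at h3
    simp only [zero_smul, add_zero] at h3
    have h4 := h.dirD_unit hb hz (eX i)
    linear_combination -h3 - h4 / 2 + (dirD (eX i) R z / 2) * hk
  have htime : (dirD eT ρ z + k / 2) * dirD eT R z + dirD eT α z * dirD eT X z +
      dirD eT γ z * dirD eT Y z = 0 := by
    have h4 := h.dirD_unit hb hz eT
    rw [hk]
    have h5 := h.R_t z hz
    have h6 := h.X_t z hz
    have h7 := h.Y_t z hz
    linear_combination h4 / 2 + dirD eT ρ z * h5 + dirD eT α z * h6 + dirD eT γ z * h7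
  have hdet := h.jacobian z hz
  have hn0 := h.normal 0 z hz
  have hn1 := h.normal 1 z hz
  have hs0 := hspace 0
  have hs1 := hspace 1
  have hρ := (h.ρ_pos z hz).ne'
  -- The covector `(κ, ∂α/∂t, ∂γ/∂t)` annihilates both spatial tangents and the velocity. The first
  -- two force it to be proportional to `(ρ, α, γ)`, by Cramer's rule with the nonzero planar
  -- Jacobian; the pairing of `(ρ, α, γ)` with the velocity is 1, so the factor vanishes.
  set κ := dirD eT ρ z + k / 2
  have hP : ρ z * dirD eT α z - κ * α z = 0 := by
    refine (mul_eq_zero.1 ?_).resolve_right hdet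
    linear_combination dirD (eX 1) Y z * (ρ z * hs0 - κ * hn0) -
      dirD (eX 0) Y z * (ρ z * hs1 - κ * hn1)
  have hQ : ρ z * dirD eT γ z - κ * γ z = 0 := by
    refine (mul_eq_zero.1 ?_).resolve_right hdet
    linear_combination dirD (eX 0) X z * (ρ z * hs1 - κ * hn1) -
      dirD (eX 1) X z * (ρ z * hs0 - κ * hn0)
  have hone : ρ z * dirD eT R z + α z * dirD eT X z + γ z * dirD eT Y z = 1 := by
    rw [h.R_t z hz, h.X_t z hz, h.Y_t z hz, ← h.unit z hz]
    ring
  have hκ : κ = 0 := by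
    linear_combination ρ z * htime - κ * hone - dirD eT X z * hP - dirD eT Y z * hQ
  rw [hκ] at hP hQ
  exact ⟨(mul_eq_zero.1 (by linear_combination hP)).resolve_left hρ,
    (mul_eq_zero.1 (by linear_combination hQ)).resolve_left hρ⟩

end LagrangianFlow

/-! ### The normal flow as a Lagrangian flow -/

/-- The coordinates of a family of maps, as functions on space-time. -/
def coordOf (φ : ℝ → (Fin 2 → ℝ) → Fin 3 → ℝ) (i : Fin 3) (z : ℝ × (Fin 2 → ℝ)) : ℝ := φ z.1 z.2 i

/-- The radial covariant velocity component. -/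
def velR (b : ℝ) (φ : ℝ → (Fin 2 → ℝ) → Fin 3 → ℝ) (z : ℝ × (Fin 2 → ℝ)) : ℝ :=
  dirD eT (coordOf φ 0) z / F b (coordOf φ 0 z)

/-- The covariant velocity component along `∂ₓ`. -/
def velX (φ : ℝ → (Fin 2 → ℝ) → Fin 3 → ℝ) (z : ℝ × (Fin 2 → ℝ)) : ℝ :=
  coordOf φ 0 z ^ 4 * dirD eT (coordOf φ 1) z

/-- The covariant velocity component along `∂_y`. -/
def velY (b : ℝ) (φ : ℝ → (Fin 2 → ℝ) → Fin 3 → ℝ) (z : ℝ × (Fin 2 → ℝ)) : ℝ :=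
  coordOf φ 0 z ^ 4 * F b (coordOf φ 0 z) * dirD eT (coordOf φ 2) z

/-- The projection of the flow to `ℝ²`. -/
def planar (φ : ℝ → (Fin 2 → ℝ) → Fin 3 → ℝ) (t : ℝ) (u : Fin 2 → ℝ) : Fin 2 → ℝ :=
  ![φ t u 1, φ t u 2]

theorem dirD_eX_eq_pd {f : ℝ × (Fin 2 → ℝ) → ℝ} (hf : ContDiffOn ℝ ∞ f posTime)
    {t : ℝ} (ht : 0 < t) (u : Fin 2 → ℝ) (i : Fin 2) :
    pd i (fun w => f (t, w)) u = dirD (eX i) f (t, u) := by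
  have hz : ((t, u) : ℝ × (Fin 2 → ℝ)) ∈ posTime := ht
  have hd : DifferentiableAt ℝ (fun w => f (t, w)) u :=
    (differentiableAt_of_posTime hf hz).comp u
      ((differentiableAt_const t).prodMk differentiableAt_id)
  refine fderiv_eq_of_line hd ?_
  refine (dirD_line hf hz (eX i)).congr_of_eventuallyEq ?_
  filter_upwards with τ
  simp [eX]

theorem dirD_eT_eq {f : ℝ × (Fin 2 → ℝ) → ℝ} (hf : ContDiffOn ℝ ∞ f posTime)
    {t : ℝ} (ht : 0 < t) (u : Fin 2 → ℝ) :
    HasDerivAt (fun τ => f (τ, u)) (dirD eT f (t, u)) t := by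
  have hz : ((t, u) : ℝ × (Fin 2 → ℝ)) ∈ posTime := ht
  have h1 : HasDerivAt (fun τ : ℝ => ((τ, u) : ℝ × (Fin 2 → ℝ))) eT t :=
    (hasDerivAt_id t).prodMk (hasDerivAt_const t u)
  exact (differentiableAt_of_posTime hf hz).hasFDerivAt.comp_hasDerivAt t h1

theorem SpaceEq.refl (b Px : ℝ) (p : Fin 3 → ℝ) : SpaceEq b Px p p :=
  ⟨rfl, 0, 0, by simp, by simp⟩

namespace IsNormalFlow

variable {b Px : ℝ} {φ : ℝ → (Fin 2 → ℝ) → Fin 3 → ℝ} {s : ℝ → (Fin 2 → ℝ) → ℝ}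

theorem contDiffOn_coordOf (h : IsNormalFlow b Px φ s) (i : Fin 3) :
    ContDiffOn ℝ ∞ (coordOf φ i) posTime := by
  have h1 := h.smooth.mono (t := posTime) fun z (hz : 0 < z.1) => ⟨hz.le, mem_univ _⟩
  exact contDiffOn_pi.1 h1 i

theorem radius_eq (h : IsNormalFlow b Px φ s) {t : ℝ} (ht : 0 ≤ t) (u : Fin 2 → ℝ) :
    φ t u 0 = s t (planar φ t u) :=
  ((h.embeds t ht).image_eq (φ t u)).1 ⟨u, SpaceEq.refl b Px _⟩

theorem rs_lt (h : IsNormalFlow b Px φ s) {t : ℝ} (ht : 0 ≤ t) (u : Fin 2 → ℝ) :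
    rs b < φ t u 0 := by
  rw [h.radius_eq ht]
  exact (h.height t ht).gt_rs _

theorem hasDerivAt_coord (hb : 0 < b) (h : IsNormalFlow b Px φ s) {t : ℝ} (ht : 0 < t)
    (u : Fin 2 → ℝ) (i : Fin 3) :
    dirD eT (coordOf φ i) (t, u) = (φ t u 0)⁻¹ *
      (√(gradSq b (φ t u 0) (pd 0 (s t) (planar φ t u)) (pd 1 (s t) (planar φ t u))))⁻¹ *
      ![φ t u 0 ^ 2 * F b (φ t u 0), -(pd 0 (s t) (planar φ t u)) / φ t u 0 ^ 2,
        -(pd 1 (s t) (planar φ t u)) / (φ t u 0 ^ 2 * F b (φ t u 0))] i := by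
  have h1 := (h.evolves t ht.le u).hasDerivAt (Ici_mem_nhds ht)
  have h2 := hasDerivAt_pi.1 h1 i
  have hr := h.rs_lt ht.le u
  rw [outwardNormal_eq (h.height t ht.le).smooth ((rs_isGreatest hb).1.1.trans hr).ne'
    (F_pos hb hr).ne'] at h2
  have h3 := (dirD_eT_eq (h.contDiffOn_coordOf i) ht u).unique h2
  rw [h3]
  simp only [Pi.smul_apply, smul_eq_mul, ← mul_assoc]
  rfl

/-- The velocity components are defined from time derivatives of `φ`, hence are smooth in
space-time; the heights `s t` are only assumed smooth in space for each fixed `t`. This lemma and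
the next two connect the two descriptions, yielding `α = -sₓ ρ` and `γ = -s_y ρ`. -/
theorem velR_eq (hb : 0 < b) (h : IsNormalFlow b Px φ s) {t : ℝ} (ht : 0 < t)
    (u : Fin 2 → ℝ) : velR b φ (t, u) = φ t u 0 *
      (√(gradSq b (φ t u 0) (pd 0 (s t) (planar φ t u)) (pd 1 (s t) (planar φ t u))))⁻¹ := by
  have hr := h.rs_lt ht.le u
  have hF := (F_pos hb hr).ne'
  have hr0 := ((rs_isGreatest hb).1.1.trans hr).ne'
  rw [velR, h.hasDerivAt_coord hb ht]
  simp only [coordOf, Matrix.cons_val_zero]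
  field_simp

theorem velX_eq (hb : 0 < b) (h : IsNormalFlow b Px φ s) {t : ℝ} (ht : 0 < t)
    (u : Fin 2 → ℝ) : velX φ (t, u) = -(pd 0 (s t) (planar φ t u)) * velR b φ (t, u) := by
  have hr := h.rs_lt ht.le u
  have hr0 := ((rs_isGreatest hb).1.1.trans hr).ne'
  rw [h.velR_eq hb ht, velX, h.hasDerivAt_coord hb ht]
  simp only [coordOf, Matrix.cons_val]
  field_simp

theorem velY_eq (hb : 0 < b) (h : IsNormalFlow b Px φ s) {t : ℝ} (ht : 0 < t)
    (u : Fin 2 → ℝ) : velY b φ (t, u) = -(pd 1 (s t) (planar φ t u)) * velR b φ (t, u) := by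
  have hr := h.rs_lt ht.le u
  have hF := (F_pos hb hr).ne'
  have hr0 := ((rs_isGreatest hb).1.1.trans hr).ne'
  rw [h.velR_eq hb ht, velY, h.hasDerivAt_coord hb ht]
  simp only [coordOf, Matrix.cons_val]
  field_simp

theorem differentiableAt_planar (h : IsNormalFlow b Px φ s) {t : ℝ} (ht : 0 < t) (u : Fin 2 → ℝ) :
    DifferentiableAt ℝ (planar φ t) u := by
  rw [differentiableAt_pi]
  have hz : ((t, u) : ℝ × (Fin 2 → ℝ)) ∈ posTime := ht
  have hd := fun i => (differentiableAt_of_posTime (h.contDiffOn_coordOf i) hz).comp u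
      ((differentiableAt_const t).prodMk differentiableAt_id)
  intro i
  fin_cases i
  · exact hd 1
  · exact hd 2

/-- The chain rule for functions on the torus composed with the flow. -/
theorem pd_comp_planar (h : IsNormalFlow b Px φ s) {t : ℝ} (ht : 0 < t) (u : Fin 2 → ℝ)
    {f : (Fin 2 → ℝ) → ℝ} (hf : Differentiable ℝ f) (i : Fin 2) :
    pd i (fun w => f (planar φ t w)) u =
      pd 0 f (planar φ t u) * dirD (eX i) (coordOf φ 1) (t, u) +
      pd 1 f (planar φ t u) * dirD (eX i) (coordOf φ 2) (t, u) := by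
  have hp := h.differentiableAt_planar ht u
  have hc := (hf (planar φ t u)).hasFDerivAt.comp u hp.hasFDerivAt
  have hv : fderiv ℝ (planar φ t) u (Pi.single i 1) =
      dirD (eX i) (coordOf φ 1) (t, u) • Pi.single 0 1 +
      dirD (eX i) (coordOf φ 2) (t, u) • Pi.single 1 1 := by
    rw [← dirD_eX_eq_pd (h.contDiffOn_coordOf 1) ht, ← dirD_eX_eq_pd (h.contDiffOn_coordOf 2) ht]
    have hpi := hasFDerivAt_pi'.1 hp.hasFDerivAt
    funext j
    have hj : fderiv ℝ (planar φ t) u (Pi.single i 1) j =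
        pd i (fun w => planar φ t w j) u := by
      rw [pd, (hpi j).fderiv]
      rfl
    rw [hj]
    fin_cases j
    · simp [planar, coordOf]
    · simp [planar, coordOf]
  have : pd i (fun w => f (planar φ t w)) u =
      fderiv ℝ f (planar φ t u) (fderiv ℝ (planar φ t) u (Pi.single i 1)) := by
    rw [pd, show (fun w => f (planar φ t w)) = f ∘ planar φ t from rfl, hc.fderiv]
    rfl
  rw [this, hv, map_add, map_smul, map_smul]
  simp only [pd, smul_eq_mul]
  ring

/-- Differentiates the relation `r = s(x, y)`, valid along the whole surface, in a parameter
direction. -/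
theorem dirD_radius (h : IsNormalFlow b Px φ s) {t : ℝ} (ht : 0 < t) (u : Fin 2 → ℝ)
    (i : Fin 2) : dirD (eX i) (coordOf φ 0) (t, u) =
      pd 0 (s t) (planar φ t u) * dirD (eX i) (coordOf φ 1) (t, u) +
      pd 1 (s t) (planar φ t u) * dirD (eX i) (coordOf φ 2) (t, u) := by
  rw [← h.pd_comp_planar ht u ((h.height t ht.le).smooth.differentiable (by simp)),
    ← dirD_eX_eq_pd (h.contDiffOn_coordOf 0) ht]
  congr 1
  funext w
  exact h.radius_eq ht.le w

theorem lagrangianFlow (hb : 0 < b) (h : IsNormalFlow b Px φ s) :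
    LagrangianFlow b (coordOf φ 0) (coordOf φ 1) (coordOf φ 2) (velR b φ) (velX φ) (velY b φ) := by
  have hc := h.contDiffOn_coordOf
  have hgt : ∀ z ∈ posTime, rs b < coordOf φ 0 z := fun z hz => h.rs_lt (le_of_lt hz) z.2
  have hpos : ∀ z ∈ posTime, 0 < coordOf φ 0 z := fun z hz =>
    (rs_isGreatest hb).1.1.trans (hgt z hz)
  have hFp : ∀ z ∈ posTime, 0 < F b (coordOf φ 0 z) := fun z hz => F_pos hb (hgt z hz)
  have hF : ContDiffOn ℝ ∞ (fun z => F b (coordOf φ 0 z)) posTime := by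
    unfold F
    exact (contDiffOn_const.sub (((hc 0).pow 3).inv fun z hz => pow_ne_zero 3 (hpos z hz).ne')).sub
      (contDiffOn_const.mul (((hc 0).pow 4).inv fun z hz => pow_ne_zero 4 (hpos z hz).ne'))
  have hG : ∀ t u, 0 < t → 0 < gradSq b (φ t u 0) (pd 0 (s t) (planar φ t u))
      (pd 1 (s t) (planar φ t u)) := by
    intro t u ht
    have h1 : 0 < φ t u 0 := hpos (t, u) ht
    have h2 : 0 < F b (φ t u 0) := hFp (t, u) ht
    unfold gradSq
    positivity
  have hvp : ∀ t u, 0 < t → 0 < velR b φ (t, u) := by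
    intro t u ht
    rw [h.velR_eq hb ht]
    exact mul_pos (hpos (t, u) ht) (inv_pos.2 (Real.sqrt_pos.2 (hG t u ht)))
  refine ⟨hc 0, hc 1, hc 2, ?_, ?_, ?_, hgt, ?_, ?_, ?_, ?_, ?_, ?_, ?_⟩
  · exact (contDiffOn_dirD (hc 0) _).div hF fun z hz => (hFp z hz).ne'
  · exact ((hc 0).pow 4).mul (contDiffOn_dirD (hc 1) _)
  · exact (((hc 0).pow 4).mul hF).mul (contDiffOn_dirD (hc 2) _)
  · exact fun z hz => hvp z.1 z.2 hz
  · intro z hz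
    have := (hFp z hz).ne'
    unfold velR
    field_simp
  · intro z hz
    have := (hpos z hz).ne'
    unfold velX
    field_simp
  · intro z hz
    have := (hpos z hz).ne'
    have := (hFp z hz).ne'
    unfold velY
    field_simp
  · rintro ⟨t, u⟩ hz
    rw [h.velX_eq hb hz, h.velY_eq hb hz, h.velR_eq hb hz]
    have h1 := hG t u hz
    have h2 : (√(gradSq b (φ t u 0) (pd 0 (s t) (planar φ t u))
      (pd 1 (s t) (planar φ t u))))⁻¹ ^ 2 = (gradSq b (φ t u 0) (pd 0 (s t) (planar φ t u))
      (pd 1 (s t) (planar φ t u)))⁻¹ := by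
      rw [inv_pow, Real.sq_sqrt h1.le]
    have h3 : 0 < φ t u 0 := hpos (t, u) hz
    have h4 : 0 < F b (φ t u 0) := hFp (t, u) hz
    simp only [coordOf, mul_pow, h2]
    have h5 := h1.ne'
    rw [gradSq] at h5 ⊢
    have h6 : gradSq b (φ t u 0) (pd 0 (s t) (planar φ t u)) (pd 1 (s t) (planar φ t u)) =
      φ t u 0 ^ 2 * (F b (φ t u 0) + pd 0 (s t) (planar φ t u) ^ 2 / φ t u 0 ^ 4 +
        pd 1 (s t) (planar φ t u) ^ 2 / (φ t u 0 ^ 4 * F b (φ t u 0))) := by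
      unfold gradSq; field_simp
    rw [← gradSq, h6]
    have h7 : F b (φ t u 0) + pd 0 (s t) (planar φ t u) ^ 2 / φ t u 0 ^ 4 +
        pd 1 (s t) (planar φ t u) ^ 2 / (φ t u 0 ^ 4 * F b (φ t u 0)) ≠ 0 := by positivity
    rw [mul_inv]
    calc _ = (F b (φ t u 0) + pd 0 (s t) (planar φ t u) ^ 2 / φ t u 0 ^ 4 +
        pd 1 (s t) (planar φ t u) ^ 2 / (φ t u 0 ^ 4 * F b (φ t u 0))) *
        (F b (φ t u 0) + pd 0 (s t) (planar φ t u) ^ 2 / φ t u 0 ^ 4 +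
        pd 1 (s t) (planar φ t u) ^ 2 / (φ t u 0 ^ 4 * F b (φ t u 0)))⁻¹ *
        (φ t u 0 ^ 2 * (φ t u 0 ^ 2)⁻¹) := by ring
      _ = 1 := by rw [mul_inv_cancel₀ h7, mul_inv_cancel₀ (pow_ne_zero 2 h3.ne'), one_mul]
  · rintro i ⟨t, u⟩ hz
    rw [h.velX_eq hb hz, h.velY_eq hb hz, h.dirD_radius hz]
    ring
  · rintro ⟨t, u⟩ hz hdet
    have hli := Fintype.linearIndependent_iff.1 ((h.embeds t (le_of_lt hz)).immersion u)
    have ht : ∀ i a, tangent (φ t) i u a = dirD (eX i) (coordOf φ a) (t, u) :=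
      fun i a => dirD_eX_eq_pd (hc a) hz u i
    have hzero : ∀ c : Fin 2 → ℝ,
        c 0 * dirD (eX 0) (coordOf φ 1) (t, u) + c 1 * dirD (eX 1) (coordOf φ 1) (t, u) = 0 →
        c 0 * dirD (eX 0) (coordOf φ 2) (t, u) + c 1 * dirD (eX 1) (coordOf φ 2) (t, u) = 0 →
        ∀ i, c i = 0 := by
      intro c h1 h2
      apply hli c
      funext a
      simp only [Fin.sum_univ_two, Pi.add_apply, Pi.smul_apply, smul_eq_mul, ht, Pi.zero_apply]
      fin_cases a
      · simp only [Fin.zero_eta, h.dirD_radius hz]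
        linear_combination pd 0 (s t) (planar φ t u) * h1 + pd 1 (s t) (planar φ t u) * h2
      · exact h1
      · exact h2
    -- The radial component of a tangent vector is determined by its planar ones. If the planar
    -- determinant vanished, these two cofactor combinations of the tangents would be zero, and
    -- independence would make the first tangent itself zero.
    have hY := hzero ![dirD (eX 1) (coordOf φ 2) (t, u), -dirD (eX 0) (coordOf φ 2) (t, u)]
      (by simp; linear_combination hdet) (by simp; ring)
    have hX := hzero ![dirD (eX 1) (coordOf φ 1) (t, u), -dirD (eX 0) (coordOf φ 1) (t, u)]
      (by simp; ring) (by simp; linear_combination -hdet)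
    have hX0 : dirD (eX 0) (coordOf φ 1) (t, u) = 0 := by simpa using hX 1
    have hY0 : dirD (eX 0) (coordOf φ 2) (t, u) = 0 := by simpa using hY 1
    have := hzero ![1, 0] (by simp [hX0]) (by simp [hY0]) 0
    simp at this

end IsNormalFlow

/-! ### Growth of the radius and bounded flow derivatives -/

theorem F_lt_one {b : ℝ} (hb : 0 < b) {r : ℝ} (hr : 0 < r) : F b r < 1 := by
  unfold F
  have : 0 < (r ^ 3)⁻¹ := by positivity
  have : 0 < b * (r ^ 4)⁻¹ := by positivity
  linarith

theorem F_mono {b : ℝ} (hb : 0 < b) {r r' : ℝ} (hr : 0 < r) (h : r ≤ r') : F b r ≤ F b r' := by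
  have h3 : (r' ^ 3)⁻¹ ≤ (r ^ 3)⁻¹ :=
    inv_anti₀ (by positivity) (pow_le_pow_left₀ hr.le h 3)
  have h4 : (r' ^ 4)⁻¹ ≤ (r ^ 4)⁻¹ :=
    inv_anti₀ (by positivity) (pow_le_pow_left₀ hr.le h 4)
  unfold F
  nlinarith

theorem dF_eq (b : ℝ) {r : ℝ} (hr : r ≠ 0) : dF b r = 3 * r⁻¹ ^ 4 + 4 * b * r⁻¹ ^ 5 := by
  unfold dF F
  field_simp
  ring

/-- Grönwall's inequality with the integrable coefficient `B / (r₀ + δ (t - 1))²`. -/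
theorem le_exp_of_deriv_le {y y' : ℝ → ℝ} {r₀ δ B : ℝ} (hr₀ : 0 < r₀) (hδ : 0 < δ) (hB : 0 ≤ B)
    (hy : ∀ t, 1 ≤ t → HasDerivAt y (y' t) t) (h0 : ∀ t, 1 ≤ t → 0 ≤ y t)
    (hle : ∀ t, 1 ≤ t → y' t ≤ B * ((r₀ + δ * (t - 1))⁻¹) ^ 2 * y t) {t : ℝ} (ht : 1 ≤ t) :
    y t ≤ y 1 * Real.exp (B / (δ * r₀)) := by
  have hℓ : ∀ t, 1 ≤ t → 0 < r₀ + δ * (t - 1) := fun t ht => by nlinarith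
  -- The exponent `(B/δ) / (r₀ + δ (t - 1))` has derivative `-B / (r₀ + δ (t - 1))²`, so it is an
  -- integrating factor; its value at `t = 1` is `B/(δ r₀)`.
  have hd : ∀ t, 1 ≤ t → HasDerivAt
      (fun τ => y τ * Real.exp (B / δ * (r₀ + δ * (τ - 1))⁻¹))
      ((y' t - B * ((r₀ + δ * (t - 1))⁻¹) ^ 2 * y t) *
        Real.exp (B / δ * (r₀ + δ * (t - 1))⁻¹)) t := by
    intro t ht
    have h1 : HasDerivAt (fun τ => r₀ + δ * (τ - 1)) δ t := by
      simpa using (((hasDerivAt_id t).sub_const 1).const_mul δ).const_add r₀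
    have h2 := ((h1.inv (hℓ t ht).ne').const_mul (B / δ)).exp
    refine ((hy t ht).mul h2).congr_deriv ?_
    have := (hℓ t ht).ne'
    simp only [Pi.inv_apply]
    field_simp
    ring
  have hanti : AntitoneOn (fun τ => y τ * Real.exp (B / δ * (r₀ + δ * (τ - 1))⁻¹)) (Ici 1) := by
    refine antitoneOn_of_deriv_nonpos (convex_Ici 1)
      (fun t ht => (hd t ht).continuousAt.continuousWithinAt) ?_ ?_
    · intro t ht
      rw [interior_Ici] at ht
      exact (hd t (le_of_lt ht)).differentiableAt.differentiableWithinAt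
    · intro t ht
      rw [interior_Ici] at ht
      rw [(hd t (le_of_lt ht)).deriv]
      exact mul_nonpos_of_nonpos_of_nonneg (sub_nonpos.2 (hle t (le_of_lt ht)))
        (Real.exp_pos _).le
  have h1 := hanti (mem_Ici.2 le_rfl) (mem_Ici.2 ht) ht
  have h2 : y t ≤ y t * Real.exp (B / δ * (r₀ + δ * (t - 1))⁻¹) := by
    refine le_mul_of_one_le_right (h0 t ht) (Real.one_le_exp ?_)
    have := hℓ t ht
    positivity
  refine h2.trans (h1.trans (le_of_eq ?_))
  simp only [sub_self, mul_zero, add_zero]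
  congr 2
  field_simp

namespace LagrangianFlow

variable {b : ℝ} {R X Y ρ α γ : ℝ × (Fin 2 → ℝ) → ℝ}

theorem const_of_dirD_eT {f : ℝ × (Fin 2 → ℝ) → ℝ} (hf : ContDiffOn ℝ ∞ f posTime)
    (h0 : ∀ z ∈ posTime, dirD eT f z = 0) {t : ℝ} (ht : 1 ≤ t) (u : Fin 2 → ℝ) :
    f (t, u) = f (1, u) := by
  have hd : ∀ τ, 1 ≤ τ → HasDerivAt (fun τ => f (τ, u)) 0 τ := by
    intro τ hτ
    have hτ0 : 0 < τ := by linarith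
    have := dirD_eT_eq hf hτ0 u
    rwa [h0 (τ, u) hτ0] at this
  exact constant_of_has_deriv_right_zero (f := fun τ => f (τ, u)) (a := 1) (b := t)
    (fun τ hτ => (hd τ hτ.1).continuousAt.continuousWithinAt)
    (fun τ hτ => (hd τ hτ.1).hasDerivWithinAt) t ⟨ht, le_rfl⟩

theorem dirD_eX_const {f : ℝ × (Fin 2 → ℝ) → ℝ} (hf : ContDiffOn ℝ ∞ f posTime)
    (h0 : ∀ z ∈ posTime, dirD eT f z = 0) {t : ℝ} (ht : 1 ≤ t) (u : Fin 2 → ℝ) (i : Fin 2) :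
    dirD (eX i) f (t, u) = dirD (eX i) f (1, u) := by
  rw [← dirD_eX_eq_pd hf (by linarith), ← dirD_eX_eq_pd hf one_pos]
  congr 1
  funext w
  exact const_of_dirD_eT hf h0 ht w

theorem R_le (hb : 0 < b) (h : LagrangianFlow b R X Y ρ α γ) {t : ℝ} (ht : 1 ≤ t)
    (u : Fin 2 → ℝ) : R (1, u) ≤ R (t, u) := by
  have hd : ∀ τ, 1 ≤ τ → HasDerivAt (fun τ => R (τ, u)) (dirD eT R (τ, u)) τ :=
    fun τ hτ => dirD_eT_eq h.smoothR (by linarith) u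
  have hm : MonotoneOn (fun τ => R (τ, u)) (Ici 1) := by
    refine monotoneOn_of_deriv_nonneg (convex_Ici 1)
      (fun t ht => (hd t ht).continuousAt.continuousWithinAt) ?_ ?_
    · intro t ht
      rw [interior_Ici] at ht
      exact (hd t (le_of_lt ht)).differentiableAt.differentiableWithinAt
    · intro t ht
      rw [interior_Ici] at ht
      have hz : ((t, u) : ℝ × (Fin 2 → ℝ)) ∈ posTime :=
        show (0 : ℝ) < t from lt_trans one_pos ht
      rw [(hd t (le_of_lt ht)).deriv, h.R_t _ hz]
      exact (mul_pos (h.F_R_pos hb hz) (h.ρ_pos _ hz)).le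
  exact hm (mem_Ici.2 le_rfl) (mem_Ici.2 ht) ht

/-- The unit-length condition multiplied by `F`: a first integral for the radius, in which only `R`
varies with time once the momenta are conserved. -/
theorem R_t_sq (hb : 0 < b) (h : LagrangianFlow b R X Y ρ α γ) {z : ℝ × (Fin 2 → ℝ)}
    (hz : z ∈ posTime) : dirD eT R z ^ 2 =
      F b (R z) * (1 - α z ^ 2 * (R z ^ 4)⁻¹) - γ z ^ 2 * (R z ^ 4)⁻¹ := by
  have h1 := h.unit z hz
  have hR := (h.R_pos hb hz).ne'
  have hF := (h.F_R_pos hb hz).ne'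
  rw [h.R_t z hz]
  have h2 : F b (R z) * (F b (R z) * ρ z ^ 2 + α z ^ 2 / R z ^ 4 +
    γ z ^ 2 / (R z ^ 4 * F b (R z))) = F b (R z) := by rw [h1, mul_one]
  have h3 : F b (R z) * (γ z ^ 2 / (R z ^ 4 * F b (R z))) = γ z ^ 2 * (R z ^ 4)⁻¹ := by
    field_simp
  linear_combination h2 - h3

/-- With frozen momenta the right side of `R_t_sq` is nondecreasing in `R`, and `R` itself
increases. -/
theorem R_t_le (hb : 0 < b) (h : LagrangianFlow b R X Y ρ α γ) {t : ℝ} (ht : 1 ≤ t)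
    (u : Fin 2 → ℝ) : dirD eT R (1, u) ≤ dirD eT R (t, u) := by
  have hz1 : ((1, u) : ℝ × (Fin 2 → ℝ)) ∈ posTime := show (0 : ℝ) < 1 from one_pos
  have hz : ((t, u) : ℝ × (Fin 2 → ℝ)) ∈ posTime :=
    show (0 : ℝ) < t from lt_of_lt_of_le one_pos ht
  have hpos : 0 ≤ dirD eT R (t, u) := by
    rw [h.R_t _ hz]
    exact (mul_pos (h.F_R_pos hb hz) (h.ρ_pos _ hz)).le
  refine le_of_sq_le_sq ?_ hpos
  have e1 := h.R_t_sq hb hz1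
  have e2 := h.R_t_sq hb hz
  rw [const_of_dirD_eT h.smoothα (fun z hz => (h.conserved hb hz).1) ht,
    const_of_dirD_eT h.smoothγ (fun z hz => (h.conserved hb hz).2) ht] at e2
  have hR1 := h.R_pos hb hz1
  have hle := h.R_le hb ht u
  have hF := F_mono hb hR1 hle
  have hF1 := h.F_R_pos hb hz1
  have hx : (R (t, u) ^ 4)⁻¹ ≤ (R (1, u) ^ 4)⁻¹ :=
    inv_anti₀ (by positivity) (pow_le_pow_left₀ hR1.le hle 4)
  have hx0 : 0 < (R (t, u) ^ 4)⁻¹ := inv_pos.2 (pow_pos (h.R_pos hb hz) 4)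
  rw [e1, e2]
  set x := (R (t, u) ^ 4)⁻¹
  set x1 := (R (1, u) ^ 4)⁻¹
  have hγ : γ (1, u) ^ 2 * x ≤ γ (1, u) ^ 2 * x1 := mul_le_mul_of_nonneg_left hx (sq_nonneg _)
  have hα : α (1, u) ^ 2 * x ≤ α (1, u) ^ 2 * x1 := mul_le_mul_of_nonneg_left hx (sq_nonneg _)
  have hγ1 : 0 ≤ γ (1, u) ^ 2 * x1 := mul_nonneg (sq_nonneg _) (hx0.le.trans hx)
  -- Otherwise the first integral would make the square of `∂R/∂t` at time 1 negative.
  have h1 : 0 ≤ 1 - α (1, u) ^ 2 * x1 := by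
    by_contra! hneg
    nlinarith [sq_nonneg (dirD eT R (1, u))]
  have h2 : F b (R (1, u)) * (1 - α (1, u) ^ 2 * x1) ≤
      F b (R (t, u)) * (1 - α (1, u) ^ 2 * x) :=
    mul_le_mul hF (by linarith) h1 (hF1.le.trans hF)
  linarith

theorem exists_bound {f : (Fin 2 → ℝ) → ℝ} {K : Set (Fin 2 → ℝ)} (hK : IsCompact K)
    (hf : Continuous f) : ∃ C, 0 < C ∧ ∀ u ∈ K, f u ≤ C := by
  obtain ⟨C, hC⟩ := hK.exists_bound_of_continuousOn hf.continuousOn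
  exact ⟨max C 1, lt_max_of_lt_right one_pos, fun u hu =>
    (le_abs_self _).trans ((hC u hu).trans (le_max_left _ _))⟩

theorem continuous_slice {f : ℝ × (Fin 2 → ℝ) → ℝ} (hf : ContDiffOn ℝ ∞ f posTime) {t : ℝ}
    (ht : 0 < t) : Continuous fun u => f (t, u) :=
  hf.continuousOn.comp_continuous (by fun_prop) fun _ => ht

end LagrangianFlow

/-- Bounds along a Lagrangian flow at time `t`, uniform over a set of initial points. -/
structure FlowBounds (b : ℝ) (R X Y ρ α γ : ℝ × (Fin 2 → ℝ) → ℝ) (δ C : ℝ)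
    (t : ℝ) (u : Fin 2 → ℝ) : Prop where
  growth : rs b + δ * (t - 1) ≤ R (t, u)
  ρ_ge : δ ≤ ρ (t, u)
  F_ge : δ ^ 2 ≤ F b (R (t, u))
  α_le : |α (t, u)| ≤ C
  γ_le : |γ (t, u)| ≤ C
  α_i : ∀ i, |dirD (eX i) α (t, u)| ≤ C
  γ_i : ∀ i, |dirD (eX i) γ (t, u)| ≤ C

namespace LagrangianFlow

variable {b : ℝ} {R X Y ρ α γ : ℝ × (Fin 2 → ℝ) → ℝ}

/-- All constants come from compactness at time 1, where two-sided derivatives exist: `δ` is the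
minimum of `∂R/∂t` and `C` dominates the momenta with their spatial derivatives. They persist by
conservation and by monotonicity of `∂R/∂t`. -/
theorem exists_flowBounds (hb : 0 < b) (h : LagrangianFlow b R X Y ρ α γ)
    {K : Set (Fin 2 → ℝ)} (hK : IsCompact K) (hne : K.Nonempty) :
    ∃ δ C, 0 < δ ∧ 0 < C ∧ ∀ t, 1 ≤ t → ∀ u ∈ K, FlowBounds b R X Y ρ α γ δ C t u := by
  have hz1 : ∀ u, ((1, u) : ℝ × (Fin 2 → ℝ)) ∈ posTime := fun u => show (0 : ℝ) < 1 from one_pos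
  have hzt : ∀ t, 1 ≤ t → ∀ u, ((t, u) : ℝ × (Fin 2 → ℝ)) ∈ posTime :=
    fun t ht u => show (0 : ℝ) < t from lt_of_lt_of_le one_pos ht
  have hct : Continuous fun u => dirD eT R (1, u) :=
    continuous_slice (contDiffOn_dirD h.smoothR eT) one_pos
  obtain ⟨u₀, -, hmin⟩ := hK.exists_isMinOn hne hct.continuousOn
  have cα := continuous_slice h.smoothα one_pos
  have cγ := continuous_slice h.smoothγ one_pos
  have cαi := fun i => continuous_slice (contDiffOn_dirD h.smoothα (eX i)) one_pos
  have cγi := fun i => continuous_slice (contDiffOn_dirD h.smoothγ (eX i)) one_pos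
  obtain ⟨C, hC0, hC⟩ := exists_bound hK ((cα.abs.add cγ.abs).add
    (((cαi 0).abs.add (cαi 1).abs).add ((cγi 0).abs.add (cγi 1).abs)))
  have h0α : ∀ z ∈ posTime, dirD eT α z = 0 := fun z hz => (h.conserved hb hz).1
  have h0γ : ∀ z ∈ posTime, dirD eT γ z = 0 := fun z hz => (h.conserved hb hz).2
  have hδ : 0 < dirD eT R (1, u₀) := by
    rw [h.R_t _ (hz1 u₀)]
    exact mul_pos (h.F_R_pos hb (hz1 u₀)) (h.ρ_pos _ (hz1 u₀))
  refine ⟨dirD eT R (1, u₀), C, hδ, hC0, fun t ht u hu => ?_⟩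
  have hδt : ∀ τ, 1 ≤ τ → dirD eT R (1, u₀) ≤ dirD eT R (τ, u) :=
    fun τ hτ => (hmin hu).trans (h.R_t_le hb hτ u)
  have hCu := hC u hu
  simp only [Pi.add_apply] at hCu
  have hα0 := abs_nonneg (α (1, u))
  have hγ0 := abs_nonneg (γ (1, u))
  have hαi0 := abs_nonneg (dirD (eX 0) α (1, u))
  have hαi1 := abs_nonneg (dirD (eX 1) α (1, u))
  have hγi0 := abs_nonneg (dirD (eX 0) γ (1, u))
  have hγi1 := abs_nonneg (dirD (eX 1) γ (1, u))
  have hF1 := F_lt_one hb (h.R_pos hb (hzt t ht u))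
  have hF0 := h.F_R_pos hb (hzt t ht u)
  have hρ0 := h.ρ_pos _ (hzt t ht u)
  have hRt := h.R_t _ (hzt t ht u)
  refine ⟨?_, ?_, ?_, ?_, ?_, ?_, ?_⟩
  · have hd : ∀ τ, 1 ≤ τ → HasDerivAt (fun τ => R (τ, u)) (dirD eT R (τ, u)) τ :=
      fun τ hτ => dirD_eT_eq h.smoothR (by linarith) u
    have hm := (convex_Ici (1 : ℝ)).mul_sub_le_image_sub_of_le_deriv
      (f := fun τ => R (τ, u)) (C := dirD eT R (1, u₀))
      (fun τ hτ => (hd τ hτ).continuousAt.continuousWithinAt)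
      (fun τ hτ => by
        rw [interior_Ici] at hτ
        exact (hd τ (le_of_lt hτ)).differentiableAt.differentiableWithinAt)
      (fun τ hτ => by
        rw [interior_Ici] at hτ
        rw [(hd τ (le_of_lt hτ)).deriv]
        exact hδt τ (le_of_lt hτ)) 1 (mem_Ici.2 le_rfl) t (mem_Ici.2 ht) ht
    have := h.R_gt _ (hz1 u)
    linarith
  -- `∂R/∂t = F ρ` with `F < 1`.
  · have := hδt t ht
    nlinarith
  · have h1 := hδt t ht
    have h2 : dirD eT R (t, u) ^ 2 ≤ F b (R (t, u)) := by
      rw [h.R_t_sq hb (hzt t ht u)]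
      have hx : 0 < (R (t, u) ^ 4)⁻¹ := inv_pos.2 (pow_pos (h.R_pos hb (hzt t ht u)) 4)
      have e1 : 0 ≤ F b (R (t, u)) * (α (t, u) ^ 2 * (R (t, u) ^ 4)⁻¹) := by positivity
      have e2 : 0 ≤ γ (t, u) ^ 2 * (R (t, u) ^ 4)⁻¹ := by positivity
      linarith
    exact (pow_le_pow_left₀ hδ.le h1 2).trans h2
  · rw [const_of_dirD_eT h.smoothα h0α ht]
    linarith
  · rw [const_of_dirD_eT h.smoothγ h0γ ht]
    linarith
  · intro i
    rw [dirD_eX_const h.smoothα h0α ht]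
    fin_cases i
    · simp only [Fin.zero_eta]; linarith
    · simp only [Fin.mk_one]; linarith
  · intro i
    rw [dirD_eX_const h.smoothγ h0γ ht]
    fin_cases i
    · simp only [Fin.zero_eta]; linarith
    · simp only [Fin.mk_one]; linarith

/-- The radial spatial derivative is controlled by the tangential ones. -/
theorem abs_dirD_R_le (h : LagrangianFlow b R X Y ρ α γ) {δ C t : ℝ} {u : Fin 2 → ℝ}
    (hδ : 0 < δ) (ht : 1 ≤ t) (B : FlowBounds b R X Y ρ α γ δ C t u) (i : Fin 2) :
    |dirD (eX i) R (t, u)| ≤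
      C / δ * (|dirD (eX i) X (t, u)| + |dirD (eX i) Y (t, u)|) := by
  have hz : ((t, u) : ℝ × (Fin 2 → ℝ)) ∈ posTime :=
    show (0 : ℝ) < t from lt_of_lt_of_le one_pos ht
  have hn := h.normal i _ hz
  have hρ := h.ρ_pos _ hz
  have h1 : ρ (t, u) * |dirD (eX i) R (t, u)| ≤
      C * (|dirD (eX i) X (t, u)| + |dirD (eX i) Y (t, u)|) := by
    calc ρ (t, u) * |dirD (eX i) R (t, u)| = |ρ (t, u) * dirD (eX i) R (t, u)| := by
          rw [abs_mul, abs_of_pos hρ]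
      _ = |-(α (t, u) * dirD (eX i) X (t, u)) - γ (t, u) * dirD (eX i) Y (t, u)| := by
          congr 1; linear_combination hn
      _ ≤ |α (t, u) * dirD (eX i) X (t, u)| + |γ (t, u) * dirD (eX i) Y (t, u)| := by
          refine (abs_sub _ _).trans ?_
          rw [abs_neg]
      _ ≤ C * |dirD (eX i) X (t, u)| + C * |dirD (eX i) Y (t, u)| := by
          rw [abs_mul, abs_mul]
          gcongr
          exacts [B.α_le, B.γ_le]
      _ = _ := by ring
  rw [div_mul_eq_mul_div, le_div_iff₀ hδ, mul_comm]
  exact (mul_le_mul_of_nonneg_right B.ρ_ge (abs_nonneg _)).trans h1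

/-- Differential inequalities for the spatial derivatives of the tangential coordinates. -/
theorem exists_deriv_bound (hb : 0 < b) (h : LagrangianFlow b R X Y ρ α γ) {δ C : ℝ}
    (hδ : 0 < δ) (hC : 0 < C) : ∃ M, 0 < M ∧ ∀ t, 1 ≤ t → ∀ u,
      FlowBounds b R X Y ρ α γ δ C t u → ∀ i,
      |dirD eT (dirD (eX i) X) (t, u)| ≤ M * (rs b + δ * (t - 1))⁻¹ ^ 2 *
        (1 + |dirD (eX i) X (t, u)| + |dirD (eX i) Y (t, u)|) ∧
      |dirD eT (dirD (eX i) Y) (t, u)| ≤ M * (rs b + δ * (t - 1))⁻¹ ^ 2 *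
        (1 + |dirD (eX i) X (t, u)| + |dirD (eX i) Y (t, u)|) := by
  have hrs : 0 < rs b := (rs_isGreatest hb).1.1
  set e := (rs b)⁻¹ with he
  have he0 : 0 < e := inv_pos.2 hrs
  set g := (δ ^ 2)⁻¹ with hg
  have hg0 : 0 < g := by positivity
  set M1 := C * e ^ 2 + 4 * C * (C / δ) * e ^ 3 with hM1
  set M2 := C * e ^ 2 * g + C * (C / δ) *
    (4 * e ^ 3 * g + (3 * e ^ 4 + 4 * b * e ^ 5) * e ^ 2 * g ^ 2) with hM2
  have hM1p : 0 < M1 := by positivity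
  have hM2p : 0 < M2 := by positivity
  refine ⟨M1 + M2, by positivity, fun t ht u B i => ?_⟩
  have hz : ((t, u) : ℝ × (Fin 2 → ℝ)) ∈ posTime :=
    show (0 : ℝ) < t from lt_of_lt_of_le one_pos ht
  have hR := h.R_pos hb hz
  have hF := h.F_R_pos hb hz
  rw [dirD_comm h.smoothX hz, dirD_comm h.smoothY hz, h.dirD_X_t hb hz, h.dirD_Y_t hb hz]
  have hℓ : 0 < rs b + δ * (t - 1) := by nlinarith
  set l := (rs b + δ * (t - 1))⁻¹ with hl
  have hl0 : 0 < l := inv_pos.2 hℓ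
  have hrl : (R (t, u))⁻¹ ≤ l := inv_anti₀ hℓ B.growth
  have hle : l ≤ e := inv_anti₀ hrs (by nlinarith)
  have hFg : (F b (R (t, u)))⁻¹ ≤ g := inv_anti₀ (by positivity) B.F_ge
  have hdF : dF b (R (t, u)) ≤ 3 * e ^ 4 + 4 * b * e ^ 5 := by
    rw [dF_eq b hR.ne']
    have hri : (R (t, u))⁻¹ ≤ e := hrl.trans hle
    have : 0 < (R (t, u))⁻¹ := inv_pos.2 hR
    gcongr
  have hdF0 : 0 ≤ dF b (R (t, u)) := by
    rw [dF_eq b hR.ne']; positivity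
  have hRi := h.abs_dirD_R_le hδ ht B i
  set S := |dirD (eX i) X (t, u)| + |dirD (eX i) Y (t, u)| with hS
  have hS0 : 0 ≤ S := by positivity
  set x := (R (t, u))⁻¹ with hx
  have hx0 : 0 < x := inv_pos.2 hR
  set y := (F b (R (t, u)))⁻¹ with hy
  have hy0 : 0 < y := inv_pos.2 hF
  -- Two powers of `1/R` are kept as `l²`, which is integrable in time as Grönwall's inequality
  -- requires; the others are absorbed into constants.
  have hx4 : x ^ 4 ≤ e ^ 2 * l ^ 2 := by
    calc x ^ 4 = x ^ 2 * x ^ 2 := by ring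
      _ ≤ e ^ 2 * l ^ 2 := by gcongr; exact hrl.trans hle
  have hx5 : x ^ 5 ≤ e ^ 3 * l ^ 2 := by
    calc x ^ 5 = x ^ 3 * x ^ 2 := by ring
      _ ≤ e ^ 3 * l ^ 2 := by gcongr; exact hrl.trans hle
  have hαi := B.α_i i
  have hγi := B.γ_i i
  have hα := B.α_le
  have hγ := B.γ_le
  have hbase : ∀ m, 0 ≤ m → m ≤ M1 + M2 → m * l ^ 2 * (1 + S) ≤
      (M1 + M2) * l ^ 2 * (1 + |dirD (eX i) X (t, u)| + |dirD (eX i) Y (t, u)|) := by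
    intro m _ hm
    rw [add_assoc (1 : ℝ), ← hS]
    gcongr
  constructor
  · refine le_trans ?_ (hbase M1 hM1p.le (by linarith))
    have e1 : dirD (eX i) α (t, u) / R (t, u) ^ 4 -
        4 * α (t, u) * dirD (eX i) R (t, u) / R (t, u) ^ 5 =
        dirD (eX i) α (t, u) * x ^ 4 - 4 * (α (t, u) * dirD (eX i) R (t, u)) * x ^ 5 := by
      rw [hx]; field_simp
    rw [e1]
    calc _ ≤ |dirD (eX i) α (t, u) * x ^ 4| +
          |4 * (α (t, u) * dirD (eX i) R (t, u)) * x ^ 5| := abs_sub _ _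
      _ = |dirD (eX i) α (t, u)| * x ^ 4 +
          4 * (|α (t, u)| * |dirD (eX i) R (t, u)|) * x ^ 5 := by
          simp only [abs_mul, abs_pow, abs_of_pos hx0, Nat.abs_ofNat]
      _ ≤ C * (e ^ 2 * l ^ 2) + 4 * (C * (C / δ * S)) * (e ^ 3 * l ^ 2) := by gcongr
      _ ≤ C * (e ^ 2 * l ^ 2) * (1 + S) + 4 * (C * (C / δ * (1 + S))) * (e ^ 3 * l ^ 2) := by
          refine add_le_add (le_mul_of_one_le_right (by positivity) (by linarith)) ?_
          gcongr
          linarith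
      _ = M1 * l ^ 2 * (1 + S) := by rw [hM1]; ring
  · refine le_trans ?_ (hbase M2 hM2p.le (by linarith))
    have e1 : dirD (eX i) γ (t, u) / (R (t, u) ^ 4 * F b (R (t, u))) -
        γ (t, u) * dirD (eX i) R (t, u) * (4 / (R (t, u) ^ 5 * F b (R (t, u))) +
          dF b (R (t, u)) / (R (t, u) ^ 4 * F b (R (t, u)) ^ 2)) =
        dirD (eX i) γ (t, u) * (x ^ 4 * y) - γ (t, u) * dirD (eX i) R (t, u) *
          (4 * x ^ 5 * y + dF b (R (t, u)) * x ^ 4 * y ^ 2) := by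
      rw [hx, hy]; field_simp
    rw [e1]
    have hw : 0 ≤ 4 * x ^ 5 * y + dF b (R (t, u)) * x ^ 4 * y ^ 2 := by positivity
    calc _ ≤ |dirD (eX i) γ (t, u) * (x ^ 4 * y)| +
          |γ (t, u) * dirD (eX i) R (t, u) *
          (4 * x ^ 5 * y + dF b (R (t, u)) * x ^ 4 * y ^ 2)| := abs_sub _ _
      _ = |dirD (eX i) γ (t, u)| * (x ^ 4 * y) + |γ (t, u)| * |dirD (eX i) R (t, u)| *
          (4 * x ^ 5 * y + dF b (R (t, u)) * x ^ 4 * y ^ 2) := by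
          rw [abs_mul, abs_of_pos (show 0 < x ^ 4 * y by positivity), abs_mul, abs_mul,
            abs_of_nonneg hw]
      _ ≤ C * (e ^ 2 * l ^ 2 * g) + C * (C / δ * S) *
          (4 * (e ^ 3 * l ^ 2) * g + (3 * e ^ 4 + 4 * b * e ^ 5) * (e ^ 2 * l ^ 2) * g ^ 2) := by
          gcongr
      _ ≤ C * (e ^ 2 * l ^ 2 * g) * (1 + S) + C * (C / δ * (1 + S)) *
          (4 * (e ^ 3 * l ^ 2) * g + (3 * e ^ 4 + 4 * b * e ^ 5) * (e ^ 2 * l ^ 2) * g ^ 2) := by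
          refine add_le_add (le_mul_of_one_le_right (by positivity) (by linarith)) ?_
          gcongr
          linarith
      _ = M2 * l ^ 2 * (1 + S) := by rw [hM2]; ring

/-- The spatial derivatives of the flow are bounded uniformly in time. -/
theorem exists_jacobian_bound (hb : 0 < b) (h : LagrangianFlow b R X Y ρ α γ)
    {K : Set (Fin 2 → ℝ)} (hK : IsCompact K) {δ C : ℝ} (hδ : 0 < δ) (hC : 0 < C)
    (B : ∀ t, 1 ≤ t → ∀ u ∈ K, FlowBounds b R X Y ρ α γ δ C t u) :
    ∃ J, 0 < J ∧ ∀ t, 1 ≤ t → ∀ u ∈ K, ∀ i,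
      |dirD (eX i) X (t, u)| ≤ J ∧ |dirD (eX i) Y (t, u)| ≤ J ∧ |dirD (eX i) R (t, u)| ≤ J := by
  have hrs : 0 < rs b := (rs_isGreatest hb).1.1
  obtain ⟨M, hM0, hM⟩ := h.exists_deriv_bound hb hδ hC
  have cX := fun i => continuous_slice (contDiffOn_dirD h.smoothX (eX i)) one_pos
  have cY := fun i => continuous_slice (contDiffOn_dirD h.smoothY (eX i)) one_pos
  -- The summand 1 absorbs the inhomogeneous term of the differential inequalities and lets the
  -- square bound control absolute values.
  have hbd := fun i => exists_bound hK ((((cX i).pow 2).add ((cY i).pow 2)).add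
    (continuous_const (y := (1 : ℝ))))
  choose C1 hC10 hC1 using hbd
  have key : ∀ t, 1 ≤ t → ∀ u ∈ K, ∀ i, dirD (eX i) X (t, u) ^ 2 + dirD (eX i) Y (t, u) ^ 2 + 1 ≤
      C1 i * Real.exp (6 * M / (δ * rs b)) := by
    intro t ht u hu i
    have hd : ∀ τ, 1 ≤ τ → HasDerivAt
        (fun τ => dirD (eX i) X (τ, u) ^ 2 + dirD (eX i) Y (τ, u) ^ 2 + 1)
        (2 * dirD (eX i) X (τ, u) * dirD eT (dirD (eX i) X) (τ, u) +
          2 * dirD (eX i) Y (τ, u) * dirD eT (dirD (eX i) Y) (τ, u)) τ := by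
      intro τ hτ
      have hτ0 : 0 < τ := by linarith
      have h1 := (dirD_eT_eq (contDiffOn_dirD h.smoothX (eX i)) hτ0 u).pow 2
      have h2 := (dirD_eT_eq (contDiffOn_dirD h.smoothY (eX i)) hτ0 u).pow 2
      refine ((h1.add h2).add_const 1).congr_deriv ?_
      simp
    refine (le_exp_of_deriv_le hrs hδ (by positivity : 0 ≤ 6 * M) hd
      (fun τ _ => by positivity) ?_ ht).trans
      (mul_le_mul_of_nonneg_right (hC1 i u hu) (Real.exp_pos _).le)
    intro τ hτ
    obtain ⟨hx, hy⟩ := hM τ hτ u (B τ hτ u hu) i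
    set l := (rs b + δ * (τ - 1))⁻¹
    set x := dirD (eX i) X (τ, u)
    set y := dirD (eX i) Y (τ, u)
    set x' := dirD eT (dirD (eX i) X) (τ, u)
    set y' := dirD eT (dirD (eX i) Y) (τ, u)
    have e1 : 2 * x * x' ≤ 2 * |x| * |x'| := by
      rw [mul_assoc, mul_assoc, ← abs_mul]
      linarith [le_abs_self (x * x')]
    have e2 : 2 * y * y' ≤ 2 * |y| * |y'| := by
      rw [mul_assoc, mul_assoc, ← abs_mul]
      linarith [le_abs_self (y * y')]
    calc 2 * x * x' + 2 * y * y' ≤ 2 * |x| * |x'| + 2 * |y| * |y'| := add_le_add e1 e2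
      _ ≤ 2 * |x| * (M * l ^ 2 * (1 + |x| + |y|)) + 2 * |y| * (M * l ^ 2 * (1 + |x| + |y|)) := by
          gcongr
      _ = 2 * (M * l ^ 2) * ((|x| + |y|) * (1 + |x| + |y|)) := by ring
      -- With `S = |x| + |y|`, one has `S² ≤ 2 (x² + y²)` and `S ≤ (1 + S²)/2`; hence the factor 3,
      -- and `6 M` in the exponent.
      _ ≤ 2 * (M * l ^ 2) * (3 * (x ^ 2 + y ^ 2 + 1)) := by
          refine mul_le_mul_of_nonneg_left ?_ (by positivity)
          rw [← sq_abs x, ← sq_abs y]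
          nlinarith [sq_nonneg (|x| - |y|), sq_nonneg (|x| + |y| - 1)]
      _ = 6 * M * l ^ 2 * (x ^ 2 + y ^ 2 + 1) := by ring
  set J := (C1 0 + C1 1) * Real.exp (6 * M / (δ * rs b)) with hJ
  have hJi : ∀ i, C1 i * Real.exp (6 * M / (δ * rs b)) ≤ J := by
    intro i
    rw [hJ]
    refine mul_le_mul_of_nonneg_right ?_ (Real.exp_pos _).le
    fin_cases i
    · exact le_add_of_nonneg_right (hC10 1).le
    · exact le_add_of_nonneg_left (hC10 0).le
  have hJ0 : 0 < J := mul_pos (add_pos (hC10 0) (hC10 1)) (Real.exp_pos _)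
  have habs : ∀ x y : ℝ, x ^ 2 + y ^ 2 + 1 ≤ J → |x| ≤ J := by
    intro x y hxy
    rw [← sq_abs x] at hxy
    nlinarith [sq_nonneg (|x| - 1), sq_nonneg y]
  refine ⟨J + C / δ * (J + J), by positivity, fun t ht u hu i => ?_⟩
  have hk := (key t ht u hu i).trans (hJi i)
  have hX := habs _ _ hk
  have hY := habs (dirD (eX i) Y (t, u)) (dirD (eX i) X (t, u)) (by linarith)
  have hR := h.abs_dirD_R_le hδ ht (B t ht u hu) i
  have hp : 0 ≤ C / δ * (J + J) := by positivity
  refine ⟨by linarith, by linarith, ?_⟩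
  have : C / δ * (|dirD (eX i) X (t, u)| + |dirD (eX i) Y (t, u)|) ≤ C / δ * (J + J) := by gcongr
  linarith

end LagrangianFlow

/-! ### Decay of the tilt along the flow -/

namespace LagrangianFlow

variable {b : ℝ} {R X Y ρ α γ : ℝ × (Fin 2 → ℝ) → ℝ}

theorem contDiffOn_F (hb : 0 < b) (h : LagrangianFlow b R X Y ρ α γ) :
    ContDiffOn ℝ ∞ (fun z => F b (R z)) posTime := by
  unfold F
  exact (contDiffOn_const.sub ((h.smoothR.pow 3).inv
      fun z hz => pow_ne_zero 3 (h.R_pos hb hz).ne')).sub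
    (contDiffOn_const.mul ((h.smoothR.pow 4).inv fun z hz => pow_ne_zero 4 (h.R_pos hb hz).ne'))

theorem contDiffOn_lagrangianTilt (hb : 0 < b) (h : LagrangianFlow b R X Y ρ α γ) :
    ContDiffOn ℝ ∞ (fun z => (F b (R z) * ρ z ^ 2)⁻¹ - 1) posTime :=
  (((h.contDiffOn_F hb).mul (h.smoothρ.pow 2)).inv fun _ hz =>
    (mul_pos (h.F_R_pos hb hz) (pow_pos (h.ρ_pos _ hz) 2)).ne').sub contDiffOn_const

/-- The unit-length condition trades the derivative of `F ρ²` for that of the tangential part,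
eliminating `dirD v ρ`, on which no bound is available, and exposing the decaying powers of `1/R`.
-/
theorem dirD_lagrangianTilt (hb : 0 < b) (h : LagrangianFlow b R X Y ρ α γ)
    {z : ℝ × (Fin 2 → ℝ)} (hz : z ∈ posTime) (v : ℝ × (Fin 2 → ℝ)) :
    dirD v (fun z => (F b (R z) * ρ z ^ 2)⁻¹ - 1) z =
      ((2 * α z * dirD v α z / R z ^ 4 - 4 * α z ^ 2 * dirD v R z / R z ^ 5) +
      (2 * γ z * dirD v γ z / (R z ^ 4 * F b (R z)) - γ z ^ 2 * dirD v R z *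
        (4 / (R z ^ 5 * F b (R z)) + dF b (R z) / (R z ^ 4 * F b (R z) ^ 2)))) *
      ((F b (R z) * ρ z ^ 2)⁻¹) ^ 2 := by
  have hp := mul_pos (h.F_R_pos hb hz) (pow_pos (h.ρ_pos _ hz) 2)
  have hne : F b (R (z + (0 : ℝ) • v)) * ρ (z + (0 : ℝ) • v) ^ 2 ≠ 0 := by simpa using hp.ne'
  refine dirD_eq_of_line (h.contDiffOn_lagrangianTilt hb) (fun _ _ => rfl) hz
    (((((h.line_F hb hz v).mul ((dirD_line h.smoothρ hz v).pow 2)).inv hne).sub_const 1).congr_deriv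
      ?_)
  have h1 := h.dirD_unit hb hz v
  simp only [Pi.mul_apply, Pi.pow_apply, zero_smul, add_zero, div_eq_mul_inv _ ((_ : ℝ) ^ 2),
    inv_pow]
  rw [← div_eq_mul_inv, ← div_eq_mul_inv]
  congr 1
  push_cast
  linear_combination -h1

/-- The tilt of the surfaces flattens out along the flow. -/
theorem exists_tilt_bound (hb : 0 < b) (h : LagrangianFlow b R X Y ρ α γ) {δ C J : ℝ}
    (hδ : 0 < δ) (hC : 0 < C) (hJ : 0 < J) : ∃ M, 0 < M ∧ ∀ t, 1 ≤ t → ∀ u,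
      FlowBounds b R X Y ρ α γ δ C t u → ∀ i, |dirD (eX i) R (t, u)| ≤ J →
      |dirD (eX i) (fun z => (F b (R z) * ρ z ^ 2)⁻¹ - 1) (t, u)| ≤
        M * (rs b + δ * (t - 1))⁻¹ := by
  have hrs : 0 < rs b := (rs_isGreatest hb).1.1
  set e := (rs b)⁻¹ with he
  have he0 : 0 < e := inv_pos.2 hrs
  set g := (δ ^ 2)⁻¹ with hg
  have hg0 : 0 < g := by positivity
  set D := 3 * e ^ 4 + 4 * b * e ^ 5 with hD
  have hD0 : 0 < D := by positivity
  refine ⟨((2 * (C * C) * e ^ 3 + 4 * C ^ 2 * J * e ^ 4) + (2 * (C * C) * e ^ 3 * g +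
    C ^ 2 * J * (4 * e ^ 4 * g + D * e ^ 3 * g ^ 2))) * (g * g) ^ 2, by positivity,
    fun t ht u B i hRi => ?_⟩
  have hz : ((t, u) : ℝ × (Fin 2 → ℝ)) ∈ posTime :=
    show (0 : ℝ) < t from lt_of_lt_of_le one_pos ht
  have hR := h.R_pos hb hz
  have hF := h.F_R_pos hb hz
  rw [h.dirD_lagrangianTilt hb hz]
  have hℓ : 0 < rs b + δ * (t - 1) := by nlinarith
  set l := (rs b + δ * (t - 1))⁻¹ with hl
  have hl0 : 0 < l := inv_pos.2 hℓ
  have hrl : (R (t, u))⁻¹ ≤ l := inv_anti₀ hℓ B.growth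
  have hle : l ≤ e := inv_anti₀ hrs (by nlinarith)
  have hFg : (F b (R (t, u)))⁻¹ ≤ g := inv_anti₀ (by positivity) B.F_ge
  have hdF : dF b (R (t, u)) ≤ D := by
    rw [dF_eq b hR.ne']
    have hri : (R (t, u))⁻¹ ≤ e := hrl.trans hle
    have : 0 < (R (t, u))⁻¹ := inv_pos.2 hR
    rw [hD]
    gcongr
  have hdF0 : 0 ≤ dF b (R (t, u)) := by
    rw [dF_eq b hR.ne']; positivity
  have hρg : (ρ (t, u) ^ 2)⁻¹ ≤ g :=
    inv_anti₀ (by positivity) (pow_le_pow_left₀ hδ.le B.ρ_ge 2)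
  have hρ0 : 0 < (ρ (t, u) ^ 2)⁻¹ := inv_pos.2 (pow_pos (h.ρ_pos _ hz) 2)
  set x := (R (t, u))⁻¹ with hx
  have hx0 : 0 < x := inv_pos.2 hR
  set y := (F b (R (t, u)))⁻¹ with hy
  have hy0 : 0 < y := inv_pos.2 hF
  -- One factor `l` suffices here: only decay is needed, not integrability in time.
  have hx4 : x ^ 4 ≤ e ^ 3 * l := by
    calc x ^ 4 = x ^ 3 * x := by ring
      _ ≤ e ^ 3 * l := by gcongr; exact hrl.trans hle
  have hx5 : x ^ 5 ≤ e ^ 4 * l := by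
    calc x ^ 5 = x ^ 4 * x := by ring
      _ ≤ e ^ 4 * l := by gcongr; exact hrl.trans hle
  have hαi := B.α_i i
  have hγi := B.γ_i i
  have hα := B.α_le
  have hγ := B.γ_le
  set a := α (t, u)
  set c := γ (t, u)
  set a' := dirD (eX i) α (t, u)
  set c' := dirD (eX i) γ (t, u)
  set r' := dirD (eX i) R (t, u)
  set f' := dF b (R (t, u))
  have e1 : (2 * a * a' / R (t, u) ^ 4 - 4 * a ^ 2 * r' / R (t, u) ^ 5) +
      (2 * c * c' / (R (t, u) ^ 4 * F b (R (t, u))) - c ^ 2 * r' *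
        (4 / (R (t, u) ^ 5 * F b (R (t, u))) + f' / (R (t, u) ^ 4 * F b (R (t, u)) ^ 2))) =
      (2 * (a * a') * x ^ 4 - 4 * a ^ 2 * r' * x ^ 5) +
      (2 * (c * c') * x ^ 4 * y - c ^ 2 * r' * (4 * x ^ 5 * y + f' * x ^ 4 * y ^ 2)) := by
    rw [hx, hy]; field_simp
  have e2 : (F b (R (t, u)) * ρ (t, u) ^ 2)⁻¹ = y * (ρ (t, u) ^ 2)⁻¹ := mul_inv _ _
  rw [e1, e2, abs_mul, abs_of_nonneg (sq_nonneg (y * (ρ (t, u) ^ 2)⁻¹))]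
  have hw : 0 ≤ 4 * x ^ 5 * y + f' * x ^ 4 * y ^ 2 := by positivity
  have ha2 : a ^ 2 ≤ C ^ 2 := by rw [← sq_abs a]; gcongr
  have hc2 : c ^ 2 ≤ C ^ 2 := by rw [← sq_abs c]; gcongr
  calc _ ≤ ((2 * (|a| * |a'|) * x ^ 4 + 4 * a ^ 2 * |r'| * x ^ 5) +
      (2 * (|c| * |c'|) * x ^ 4 * y + c ^ 2 * |r'| * (4 * x ^ 5 * y + f' * x ^ 4 * y ^ 2))) *
        (y * (ρ (t, u) ^ 2)⁻¹) ^ 2 := by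
        refine mul_le_mul_of_nonneg_right ?_ (sq_nonneg _)
        refine (abs_add_le _ _).trans (add_le_add ((abs_sub _ _).trans (le_of_eq ?_))
          ((abs_sub _ _).trans (le_of_eq ?_)))
        · simp only [abs_mul, abs_pow, abs_of_pos hx0, Nat.abs_ofNat, sq_abs]
        · rw [abs_mul (c ^ 2 * r'), abs_of_nonneg hw]
          simp only [abs_mul, abs_pow, abs_of_pos hx0, abs_of_pos hy0, Nat.abs_ofNat, sq_abs]
    _ ≤ ((2 * (C * C) * (e ^ 3 * l) + 4 * C ^ 2 * J * (e ^ 4 * l)) +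
      (2 * (C * C) * (e ^ 3 * l) * g +
        C ^ 2 * J * (4 * (e ^ 4 * l) * g + D * (e ^ 3 * l) * g ^ 2))) * (g * g) ^ 2 := by
        gcongr
    _ = _ := by ring

end LagrangianFlow

namespace IsNormalFlow

variable {b Px : ℝ} {φ : ℝ → (Fin 2 → ℝ) → Fin 3 → ℝ} {s : ℝ → (Fin 2 → ℝ) → ℝ}

/-- Substituting `α = -sₓ ρ`, `γ = -s_y ρ` into the unit-length condition factors it as `F ρ² (1 +
τ) = 1`. -/
theorem tilt_planar (hb : 0 < b) (h : IsNormalFlow b Px φ s) {t : ℝ} (ht : 0 < t)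
    (u : Fin 2 → ℝ) : tilt b (s t) (planar φ t u) =
      (F b (coordOf φ 0 (t, u)) * velR b φ (t, u) ^ 2)⁻¹ - 1 := by
  have hL := h.lagrangianFlow hb
  have hz : ((t, u) : ℝ × (Fin 2 → ℝ)) ∈ posTime := ht
  have hR := hL.R_pos hb hz
  have hF := hL.F_R_pos hb hz
  have hρ := hL.ρ_pos _ hz
  have hu := hL.unit _ hz
  rw [h.velX_eq hb ht, h.velY_eq hb ht] at hu
  unfold tilt
  rw [← h.radius_eq ht.le]
  have hc : coordOf φ 0 (t, u) = φ t u 0 := rfl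
  rw [hc] at hR hF hu ⊢
  field_simp
  field_simp at hu
  linear_combination hu

end IsNormalFlow

/-! ### Integration over the torus and change of variables -/

open MeasureTheory

/-- The lattice vector with integer coordinates `n` with respect to the periods `P`. -/
def latticeVec (P : Fin 2 → ℝ) (n : Fin 2 → ℤ) : Fin 2 → ℝ := fun i => n i * P i

/-- The half-open fundamental box of the lattice with periods `P`. -/
def periodBox (P : Fin 2 → ℝ) : Set (Fin 2 → ℝ) := Set.pi univ fun i => Ico 0 (P i)

theorem measurableSet_periodBox (P : Fin 2 → ℝ) : MeasurableSet (periodBox P) :=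
  MeasurableSet.univ_pi fun _ => measurableSet_Ico

theorem lattice_unique {P : Fin 2 → ℝ} (hP : ∀ i, 0 < P i) {w : Fin 2 → ℝ} {m n : Fin 2 → ℤ}
    (hm : w + latticeVec P m ∈ periodBox P) (hn : w + latticeVec P n ∈ periodBox P) : m = n := by
  funext i
  have h1 := hm i (mem_univ i)
  have h2 := hn i (mem_univ i)
  simp only [Pi.add_apply, latticeVec, mem_Ico] at h1 h2
  have hPi := hP i
  have h3 : ((m i : ℝ) - n i) < 1 := by nlinarith
  have h4 : ((n i : ℝ) - m i) < 1 := by nlinarith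
  have h5 : m i - n i < 1 := by exact_mod_cast h3
  have h6 : n i - m i < 1 := by exact_mod_cast h4
  omega

theorem exists_lattice_mem {P : Fin 2 → ℝ} (hP : ∀ i, 0 < P i) (w : Fin 2 → ℝ) :
    ∃ n, w + latticeVec P n ∈ periodBox P := by
  refine ⟨fun i => -⌊w i / P i⌋, fun i _ => ?_⟩
  have hPi := hP i
  have h1 := Int.floor_le (w i / P i)
  have h2 := Int.lt_floor_add_one (w i / P i)
  rw [le_div_iff₀ hPi] at h1
  rw [div_lt_iff₀ hPi] at h2
  simp only [Pi.add_apply, latticeVec, mem_Ico, Int.cast_neg]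
  constructor <;> linarith

/-- Change of variables for self-maps of a torus, lifted to the plane. -/
theorem lintegral_periodBox_le {P : Fin 2 → ℝ} (hP : ∀ i, 0 < P i)
    {g : (Fin 2 → ℝ) → ENNReal} (hg : ∀ w n, g (w + latticeVec P n) = g w)
    {Ψ : (Fin 2 → ℝ) → Fin 2 → ℝ} (hΨ : Differentiable ℝ Ψ)
    (hinj : ∀ u v n, Ψ v = Ψ u + latticeVec P n → ∃ m, v = u + latticeVec P m)
    (hsurj : ∀ w, ∃ u ∈ periodBox P, ∃ n, w = Ψ u + latticeVec P n) :
    ∫⁻ u in periodBox P, g u ≤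
      ∫⁻ u in periodBox P, ENNReal.ofReal |(fderiv ℝ Ψ u).det| * g (Ψ u) := by
  have hΨinj : InjOn Ψ (periodBox P) := by
    intro u hu v hv huv
    obtain ⟨m, hm⟩ := hinj u v 0 (by rw [huv]; funext i; simp [latticeVec])
    have h0 : u + latticeVec P 0 = u := by funext i; simp [latticeVec]
    have := lattice_unique hP (w := u) (m := m) (n := 0) (by rwa [← hm]) (by rwa [h0])
    rw [hm, this, h0]
  rw [← lintegral_image_eq_lintegral_abs_det_fderiv_mul volume (measurableSet_periodBox P)
    (fun u _ => (hΨ u).hasFDerivAt.hasFDerivWithinAt) hΨinj g]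
  set S := Ψ '' periodBox P with hS
  -- `Ψ` need not preserve the box. Surjectivity modulo the lattice covers the box by translates of
  -- pieces of the image `S`; translated back, these pieces are disjoint subsets of `S`, since a
  -- point has only one translate in the box.
  have hcover : periodBox P ⊆ ⋃ n, periodBox P ∩ (fun w => w + latticeVec P n) '' S := by
    intro w hw
    obtain ⟨u, hu, n, hn⟩ := hsurj w
    exact mem_iUnion.2 ⟨n, hw, Ψ u, mem_image_of_mem Ψ hu, hn.symm⟩
  have htrans : ∀ n, ∫⁻ w in periodBox P ∩ (fun w => w + latticeVec P n) '' S, g w =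
      ∫⁻ w in (fun w => w + latticeVec P n) ⁻¹' periodBox P, g w ∂(volume.restrict S) := by
    intro n
    have hmeas : Measurable fun w : Fin 2 → ℝ => w + latticeVec P n := measurable_add_const _
    rw [Measure.restrict_restrict (hmeas (measurableSet_periodBox P))]
    have hmp := measurePreserving_add_right (volume : Measure (Fin 2 → ℝ)) (latticeVec P n)
    have hme : MeasurableEmbedding fun w : Fin 2 → ℝ => w + latticeVec P n :=
      measurableEmbedding_addRight _
    have h1 := hmp.setLIntegral_comp_preimage_emb hme g
      (periodBox P ∩ (fun w => w + latticeVec P n) '' S)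
    rw [← h1, preimage_inter, preimage_image_eq _ (add_left_injective _)]
    simp only [hg]
  calc ∫⁻ u in periodBox P, g u
      ≤ ∫⁻ u in ⋃ n, periodBox P ∩ (fun w => w + latticeVec P n) '' S, g u :=
        lintegral_mono_set hcover
    _ ≤ ∑' n, ∫⁻ u in periodBox P ∩ (fun w => w + latticeVec P n) '' S, g u :=
        lintegral_iUnion_le _ _
    _ = ∑' n, ∫⁻ w in (fun w => w + latticeVec P n) ⁻¹' periodBox P, g w ∂(volume.restrict S) :=
        tsum_congr htrans
    _ = ∫⁻ w in ⋃ n, (fun w => w + latticeVec P n) ⁻¹' periodBox P, g w ∂(volume.restrict S) := by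
        refine (lintegral_iUnion (fun n => (measurable_add_const _)
          (measurableSet_periodBox P)) ?_ _).symm
        intro m n hmn
        refine Set.disjoint_left.2 fun w hm hn => hmn (lattice_unique hP hm hn)
    _ ≤ ∫⁻ w in S, g w := setLIntegral_le_lintegral _ _

theorem volume_periodBox (P : Fin 2 → ℝ) :
    volume (periodBox P) = ENNReal.ofReal (P 0) * ENNReal.ofReal (P 1) := by
  rw [periodBox, volume_pi_pi, Fin.prod_univ_two, Real.volume_Ico, Real.volume_Ico, sub_zero,
    sub_zero]

theorem intervalIntegral_eq_periodBox {P : Fin 2 → ℝ} (hP : ∀ i, 0 < P i)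
    {G : (Fin 2 → ℝ) → ℝ} (hG : Continuous G) :
    ∫ x in (0)..P 0, ∫ y in (0)..P 1, G ![x, y] = ∫ u in periodBox P, G u := by
  have hmp := (volume_preserving_finTwoArrow ℝ).symm
  have hme := (MeasurableEquiv.finTwoArrow (α := ℝ)).symm.measurableEmbedding
  have hpre : (MeasurableEquiv.finTwoArrow (α := ℝ)).symm ⁻¹' periodBox P =
      Ico 0 (P 0) ×ˢ Ico 0 (P 1) := by
    ext ⟨x, y⟩
    simp [periodBox, MeasurableEquiv.finTwoArrow, Set.mem_pi, Fin.forall_fin_two]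
  rw [← hmp.setIntegral_preimage_emb hme, hpre]
  have hfun : ∀ z : ℝ × ℝ, G ((MeasurableEquiv.finTwoArrow (α := ℝ)).symm z) = G ![z.1, z.2] := by
    intro z
    rfl
  simp only [hfun]
  have hc : Continuous fun z : ℝ × ℝ => G ![z.1, z.2] := by
    refine hG.comp (continuous_pi fun i => ?_)
    fin_cases i
    · exact continuous_fst
    · exact continuous_snd
  have hint : IntegrableOn (fun z : ℝ × ℝ => G ![z.1, z.2]) (Ico 0 (P 0) ×ˢ Ico 0 (P 1))
      (volume.prod volume) :=
    (hc.continuousOn.integrableOn_compact (isCompact_Icc.prod isCompact_Icc)).mono_set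
      (prod_mono Ico_subset_Icc_self Ico_subset_Icc_self)
  rw [Measure.volume_eq_prod, setIntegral_prod _ hint, intervalIntegral.integral_of_le (hP 0).le,
    integral_Ico_eq_integral_Ioc]
  congr 1
  funext x
  rw [intervalIntegral.integral_of_le (hP 1).le, integral_Ico_eq_integral_Ioc]

/-- The `L¹` norm of a function on a torus, estimated after a change of variables. -/
theorem integral_abs_le_of_comp {P : Fin 2 → ℝ} (hP : ∀ i, 0 < P i)
    {f : (Fin 2 → ℝ) → ℝ} (hf : Continuous f) (hper : ∀ w n, f (w + latticeVec P n) = f w)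
    {Ψ : (Fin 2 → ℝ) → Fin 2 → ℝ} (hΨ : Differentiable ℝ Ψ)
    (hinj : ∀ u v n, Ψ v = Ψ u + latticeVec P n → ∃ m, v = u + latticeVec P m)
    (hsurj : ∀ w, ∃ u ∈ periodBox P, ∃ n, w = Ψ u + latticeVec P n)
    {B : ℝ} (hB : 0 ≤ B) (hle : ∀ u ∈ periodBox P, |(fderiv ℝ Ψ u).det| * |f (Ψ u)| ≤ B) :
    ∫ u in periodBox P, |f u| ≤ B * (P 0 * P 1) := by
  rw [integral_eq_lintegral_of_nonneg_ae (Eventually.of_forall fun _ => abs_nonneg _)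
    hf.abs.aestronglyMeasurable]
  have h1 : ∫⁻ u in periodBox P, ENNReal.ofReal |f u| ≤ ENNReal.ofReal (B * (P 0 * P 1)) := by
    refine (lintegral_periodBox_le hP (g := fun u => ENNReal.ofReal |f u|)
      (fun w n => by rw [hper]) hΨ hinj hsurj).trans ?_
    calc _ ≤ ∫⁻ u in periodBox P, ENNReal.ofReal B := by
          refine setLIntegral_mono measurable_const fun u hu => ?_
          rw [← ENNReal.ofReal_mul (abs_nonneg _)]
          exact ENNReal.ofReal_le_ofReal (hle u hu)
      _ = ENNReal.ofReal (B * (P 0 * P 1)) := by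
          rw [setLIntegral_const, volume_periodBox, ENNReal.ofReal_mul hB,
            ENNReal.ofReal_mul (hP 0).le]
  have hnn : 0 ≤ B * (P 0 * P 1) := mul_nonneg hB (mul_nonneg (hP 0).le (hP 1).le)
  calc _ ≤ (ENNReal.ofReal (B * (P 0 * P 1))).toReal := ENNReal.toReal_mono ENNReal.ofReal_ne_top h1
    _ = _ := ENNReal.toReal_ofReal hnn

theorem continuous_vec2 : Continuous fun z : ℝ × ℝ => ![z.1, z.2] := by
  refine continuous_pi fun i => ?_
  fin_cases i
  · exact continuous_fst
  · exact continuous_snd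

theorem integral_pd_eq_zero {P : Fin 2 → ℝ} (hP : ∀ i, 0 < P i) {g : (Fin 2 → ℝ) → ℝ}
    (hg : ContDiff ℝ ∞ g) (hper : ∀ w n, g (w + latticeVec P n) = g w) (k : Fin 2) :
    ∫ u in periodBox P, pd k g u = 0 := by
  have hc : Continuous (pd k g) := (contDiff_pd hg k).continuous
  have hd : Differentiable ℝ g := hg.differentiable (by simp)
  have hvec : Continuous fun z : ℝ × ℝ => pd k g ![z.1, z.2] := hc.comp continuous_vec2
  have hx : ∀ x y : ℝ, HasDerivAt (fun τ => g ![τ, y]) (pd 0 g ![x, y]) x := by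
    intro x y
    have h1 : HasDerivAt (fun τ : ℝ => ![τ, y]) (Pi.single 0 1) x := by
      rw [hasDerivAt_pi]
      intro i
      fin_cases i
      · simpa using hasDerivAt_id' x
      · simpa using hasDerivAt_const x y
    exact (hd _).hasFDerivAt.comp_hasDerivAt x h1
  have hy : ∀ x y : ℝ, HasDerivAt (fun τ => g ![x, τ]) (pd 1 g ![x, y]) y := by
    intro x y
    have h1 : HasDerivAt (fun τ : ℝ => ![x, τ]) (Pi.single 1 1) y := by
      rw [hasDerivAt_pi]
      intro i
      fin_cases i
      · simpa using hasDerivAt_const y x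
      · simpa using hasDerivAt_id' y
    exact (hd _).hasFDerivAt.comp_hasDerivAt y h1
  rw [← intervalIntegral_eq_periodBox hP hc]
  fin_cases k
  -- Fubini puts the `x`-integral inside, where the fundamental theorem and periodicity apply.
  · rw [intervalIntegral_intervalIntegral_swap]
    · have h0 : ∀ y : ℝ, ∫ x in (0)..P 0, pd 0 g ![x, y] = 0 := by
        intro y
        rw [intervalIntegral.integral_eq_sub_of_hasDerivAt (fun x _ => hx x y)
          ((hvec.comp (by fun_prop : Continuous fun x : ℝ => (x, y))).intervalIntegrable _ _)]
        rw [← hper ![0, y] ![1, 0], sub_eq_zero]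
        congr 1
        funext i
        fin_cases i <;> simp [latticeVec]
      simp only [Fin.zero_eta, h0, intervalIntegral.integral_zero]
    · exact (hvec.continuousOn.integrableOn_compact (isCompact_uIcc.prod isCompact_uIcc)).mono_set
        (prod_mono uIoc_subset_uIcc uIoc_subset_uIcc)
  · have h0 : ∀ x : ℝ, ∫ y in (0)..P 1, pd 1 g ![x, y] = 0 := by
      intro x
      rw [intervalIntegral.integral_eq_sub_of_hasDerivAt (fun y _ => hy x y)
        ((hvec.comp (by fun_prop : Continuous fun y : ℝ => (x, y))).intervalIntegrable _ _)]
      rw [← hper ![x, 0] ![0, 1], sub_eq_zero]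
      congr 1
      funext i
      fin_cases i <;> simp [latticeVec]
    simp only [Fin.mk_one, h0, intervalIntegral.integral_zero]

theorem pd_periodic {P : Fin 2 → ℝ} {g : (Fin 2 → ℝ) → ℝ}
    (hper : ∀ w n, g (w + latticeVec P n) = g w) (k : Fin 2) (w : Fin 2 → ℝ) (n : Fin 2 → ℤ) :
    pd k g (w + latticeVec P n) = pd k g w := by
  have h := fderiv_comp_add_right (𝕜 := ℝ) (f := g) (x := w) (latticeVec P n)
  simp only [hper] at h
  rw [pd, pd, ← h]

/-! ### The flow on the torus and the integral of the tilt gradient -/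

/-- The periods of the torus. -/
def periods (b Px : ℝ) : Fin 2 → ℝ := ![Px, Py b]

theorem Py_pos {b : ℝ} (hb : 0 < b) : 0 < Py b := by
  have hrs := (rs_isGreatest hb).1.1
  have hd : deriv (F b) (rs b) = dF b (rs b) := (hasDerivAt_F b hrs.ne').deriv
  unfold Py
  rw [hd, dF_eq b hrs.ne']
  positivity

theorem periods_pos {b Px : ℝ} (hb : 0 < b) (hPx : 0 < Px) (i : Fin 2) : 0 < periods b Px i := by
  fin_cases i
  · exact hPx
  · exact Py_pos hb

theorem torusEq_iff {b Px : ℝ} {u v : Fin 2 → ℝ} :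
    TorusEq b Px u v ↔ ∃ n, v = u + latticeVec (periods b Px) n := by
  constructor
  · rintro ⟨m, n, h0, h1⟩
    refine ⟨![m, n], ?_⟩
    funext i
    fin_cases i
    · simpa [latticeVec, periods] using h0
    · simpa [latticeVec, periods] using h1
  · rintro ⟨n, rfl⟩
    exact ⟨n 0, n 1, by simp [latticeVec, periods], by simp [latticeVec, periods]⟩

theorem IsHeightFunction.per {b Px : ℝ} {s : (Fin 2 → ℝ) → ℝ} (hs : IsHeightFunction b Px s)
    (w : Fin 2 → ℝ) (n : Fin 2 → ℤ) : s (w + latticeVec (periods b Px) n) = s w :=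
  (hs.periodic _ _ (torusEq_iff.2 ⟨n, rfl⟩)).symm

theorem tilt_periodic {b Px : ℝ} {s : (Fin 2 → ℝ) → ℝ} (hs : IsHeightFunction b Px s)
    (w : Fin 2 → ℝ) (n : Fin 2 → ℤ) :
    tilt b s (w + latticeVec (periods b Px) n) = tilt b s w := by
  simp only [tilt, hs.per, pd_periodic hs.per]

theorem latticeVec_add (P : Fin 2 → ℝ) (m n : Fin 2 → ℤ) :
    latticeVec P (m + n) = latticeVec P m + latticeVec P n := by
  funext i; simp [latticeVec, add_mul]

theorem latticeVec_neg (P : Fin 2 → ℝ) (m : Fin 2 → ℤ) :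
    latticeVec P (-m) = -latticeVec P m := by
  funext i; simp [latticeVec]

namespace IsNormalFlow

variable {b Px : ℝ} {φ : ℝ → (Fin 2 → ℝ) → Fin 3 → ℝ} {s : ℝ → (Fin 2 → ℝ) → ℝ}

theorem planar_injective (h : IsNormalFlow b Px φ s) {t : ℝ} (ht : 0 ≤ t) (u v : Fin 2 → ℝ)
    (n : Fin 2 → ℤ) (huv : planar φ t v = planar φ t u + latticeVec (periods b Px) n) :
    ∃ m, v = u + latticeVec (periods b Px) m := by
  refine torusEq_iff.1 ((h.embeds t ht).injective u v ⟨?_, torusEq_iff.2 ⟨n, huv⟩⟩)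
  rw [h.radius_eq ht, h.radius_eq ht, huv, (h.height t ht).per]

/-- The image condition supplies a preimage in the plane; descent to the torus allows moving it into
the fundamental box. -/
theorem planar_surjective (hb : 0 < b) (hPx : 0 < Px) (h : IsNormalFlow b Px φ s) {t : ℝ}
    (ht : 0 ≤ t) (w : Fin 2 → ℝ) : ∃ u ∈ periodBox (periods b Px), ∃ n,
      w = planar φ t u + latticeVec (periods b Px) n := by
  have hw : w = ![w 0, w 1] := by funext i; fin_cases i <;> rfl
  obtain ⟨u, hu⟩ := ((h.embeds t ht).image_eq ![s t w, w 0, w 1]).2 (by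
    simp only [Matrix.cons_val]
    rw [← hw])
  obtain ⟨m, hm⟩ := torusEq_iff.1 hu.2
  obtain ⟨k, hk⟩ := exists_lattice_mem (periods_pos hb hPx) u
  obtain ⟨l, hl⟩ := torusEq_iff.1
    ((h.embeds t ht).descends u _ (torusEq_iff.2 ⟨k, rfl⟩)).2
  refine ⟨_, hk, m + -l, ?_⟩
  have h1 : w = planar φ t u + latticeVec (periods b Px) m := by
    rw [hw]; exact hm
  have h2 : planar φ t (u + latticeVec (periods b Px) k) =
    planar φ t u + latticeVec (periods b Px) l := hl
  rw [h1, h2, latticeVec_add, latticeVec_neg]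
  abel

theorem det_planar (h : IsNormalFlow b Px φ s) {t : ℝ} (ht : 0 < t) (u : Fin 2 → ℝ) :
    (fderiv ℝ (planar φ t) u).det =
      dirD (eX 0) (coordOf φ 1) (t, u) * dirD (eX 1) (coordOf φ 2) (t, u) -
      dirD (eX 1) (coordOf φ 1) (t, u) * dirD (eX 0) (coordOf φ 2) (t, u) := by
  have hpi := hasFDerivAt_pi'.1 (h.differentiableAt_planar ht u).hasFDerivAt
  have hj : ∀ i j, fderiv ℝ (planar φ t) u (Pi.single i 1) j =
      pd i (fun w => planar φ t w j) u := by
    intro i j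
    rw [pd, (hpi j).fderiv]
    rfl
  have h1 : ∀ i, pd i (fun w => planar φ t w 0) u = dirD (eX i) (coordOf φ 1) (t, u) :=
    fun i => dirD_eX_eq_pd (h.contDiffOn_coordOf 1) ht u i
  have h2 : ∀ i, pd i (fun w => planar φ t w 1) u = dirD (eX i) (coordOf φ 2) (t, u) :=
    fun i => dirD_eX_eq_pd (h.contDiffOn_coordOf 2) ht u i
  change LinearMap.det ((fderiv ℝ (planar φ t) u : (Fin 2 → ℝ) →L[ℝ] Fin 2 → ℝ) :
    (Fin 2 → ℝ) →ₗ[ℝ] Fin 2 → ℝ) = _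
  rw [← LinearMap.det_toMatrix', Matrix.det_fin_two]
  simp only [LinearMap.toMatrix'_apply, ContinuousLinearMap.coe_coe, hj, h1, h2]

/-- The `L¹` norm of the gradient of the tilt decays along the flow. -/
theorem integral_abs_pd_tilt_le (hb : 0 < b) (hPx : 0 < Px) (h : IsNormalFlow b Px φ s)
    {t J B : ℝ} (ht : 0 < t) (hJ0 : 0 ≤ J) (hB0 : 0 ≤ B)
    (hJ : ∀ u ∈ periodBox (periods b Px), ∀ i, |dirD (eX i) (coordOf φ 1) (t, u)| ≤ J ∧
      |dirD (eX i) (coordOf φ 2) (t, u)| ≤ J)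
    (hB : ∀ u ∈ periodBox (periods b Px), ∀ i,
      |dirD (eX i) (fun z => (F b (coordOf φ 0 z) * velR b φ z ^ 2)⁻¹ - 1) (t, u)| ≤ B)
    (k : Fin 2) :
    ∫ u in periodBox (periods b Px), |pd k (tilt b (s t)) u| ≤
      2 * (J * B) * (periods b Px 0 * periods b Px 1) := by
  have hs := h.height t ht.le
  have hrs := (rs_isGreatest hb).1.1
  have hsm := contDiff_tilt (b := b) hs.smooth (fun u => (hrs.trans (hs.gt_rs u)).ne')
    (fun u => (F_pos hb (hs.gt_rs u)).ne')
  refine integral_abs_le_of_comp (periods_pos hb hPx) (contDiff_pd hsm k).continuous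
    (pd_periodic (tilt_periodic hs) k) (fun u => h.differentiableAt_planar ht u)
    (h.planar_injective ht.le) (h.planar_surjective hb hPx ht.le) (by positivity)
    fun u hu => ?_
  rw [← abs_mul, h.det_planar ht]
  have hL := h.lagrangianFlow hb
  have hchain : ∀ i, dirD (eX i) (fun z => (F b (coordOf φ 0 z) * velR b φ z ^ 2)⁻¹ - 1) (t, u) =
      pd 0 (tilt b (s t)) (planar φ t u) * dirD (eX i) (coordOf φ 1) (t, u) +
      pd 1 (tilt b (s t)) (planar φ t u) * dirD (eX i) (coordOf φ 2) (t, u) := by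
    intro i
    rw [← h.pd_comp_planar ht u (hsm.differentiable (by simp)),
      ← dirD_eX_eq_pd (hL.contDiffOn_lagrangianTilt hb) ht]
    congr 1
    funext w
    exact (h.tilt_planar hb ht w).symm
  have hbound : ∀ x y x' y' : ℝ, |x| ≤ J → |y| ≤ J → |x'| ≤ B → |y'| ≤ B →
      |x * x' - y * y'| ≤ 2 * (J * B) := by
    intro x y x' y' hx hy hx' hy'
    calc |x * x' - y * y'| ≤ |x * x'| + |y * y'| := abs_sub _ _
      _ ≤ J * B + J * B := by
          rw [abs_mul, abs_mul]
          gcongr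
      _ = _ := by ring
  -- Cramer's rule: the Jacobian determinant times an Eulerian derivative of the tilt is a cofactor
  -- combination of its Lagrangian derivatives. Upper bounds on the flow derivatives therefore
  -- suffice.
  fin_cases k
  · refine le_trans (le_of_eq (congrArg _ ?_)) (hbound _ _ _ _ (hJ u hu 1).2 (hJ u hu 0).2
      (hB u hu 0) (hB u hu 1))
    rw [hchain, hchain]
    simp only [Fin.zero_eta]
    ring
  · refine le_trans (le_of_eq (congrArg _ ?_)) (hbound _ _ _ _ (hJ u hu 0).1 (hJ u hu 1).1
      (hB u hu 1) (hB u hu 0))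
    rw [hchain, hchain]
    simp only [Fin.mk_one]
    ring

end IsNormalFlow

/-! ### Evaluation of Q and control of the remainder -/

theorem integrableOn_periodBox {P : Fin 2 → ℝ} {f : (Fin 2 → ℝ) → ℝ} (hf : Continuous f) :
    IntegrableOn f (periodBox P) := by
  refine (hf.continuousOn.integrableOn_compact
    (isCompact_Icc (a := (0 : Fin 2 → ℝ)) (b := P))).mono_set ?_
  intro u hu
  exact ⟨fun i => (hu i (mem_univ i)).1, fun i => (hu i (mem_univ i)).2.le⟩

theorem integral_const_periodBox {P : Fin 2 → ℝ} (hP : ∀ i, 0 < P i) (c : ℝ) :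
    ∫ _ in periodBox P, c = c * (P 0 * P 1) := by
  rw [setIntegral_const, measureReal_def, volume_periodBox, ENNReal.toReal_mul,
    ENNReal.toReal_ofReal (hP 0).le, ENNReal.toReal_ofReal (hP 1).le, smul_eq_mul, mul_comm]

theorem integral_volume {b : ℝ} (hb : 0 < b) {r₁ : ℝ} (h : rs b < r₁) (x y : ℝ) :
    ∫ r in (rs b)..r₁, r * √(metric b ![r, x, y]).det = (r₁ ^ 3 - rs b ^ 3) / 3 := by
  have hrs := (rs_isGreatest hb).1.1
  have h1 : ∫ r in (rs b)..r₁, r * √(metric b ![r, x, y]).det = ∫ r in (rs b)..r₁, r ^ 2 := by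
    refine intervalIntegral.integral_congr_ae (Eventually.of_forall fun r hr => ?_)
    rw [uIoc_of_le h.le] at hr
    have hr0 : 0 < r := hrs.trans hr.1
    have hF := F_pos hb hr.1
    -- The factors of `F` cancel for `r > r_s`; the half-open interval of integration excludes the
    -- root, where this would fail.
    have hdet : (metric b ![r, x, y]).det = r ^ 2 := by
      rw [metric, Matrix.det_diagonal, Fin.prod_univ_three]
      simp
      field_simp
    rw [hdet, Real.sqrt_sq hr0.le]
    ring
  rw [h1, integral_pow]
  norm_num

/-- The part of the integrand of `Q` which is not constant or in divergence form. -/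
def remainder (b : ℝ) (s : (Fin 2 → ℝ) → ℝ) (u : Fin 2 → ℝ) : ℝ :=
  (pd 0 s u ^ 2 * (2 / s u + (4 * s u ^ 3 * (1 - F b (s u)) - 1) / s u ^ 4 / (2 * F b (s u))) +
    2 * pd 1 s u ^ 2 / (s u * F b (s u))) +
  (pd 0 s u * pd 0 (tilt b s) u + pd 1 s u / F b (s u) * pd 1 (tilt b s) u) /
    (2 * (1 + tilt b s u))

theorem tilt_nonneg {b : ℝ} {s : (Fin 2 → ℝ) → ℝ} {u : Fin 2 → ℝ} (hs : 0 < s u)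
    (hF : 0 < F b (s u)) : 0 ≤ tilt b s u := by
  unfold tilt; positivity

theorem continuous_remainder {b : ℝ} {s : (Fin 2 → ℝ) → ℝ} (hs : ContDiff ℝ ∞ s)
    (h0 : ∀ u, 0 < s u) (hF : ∀ u, 0 < F b (s u)) : Continuous (remainder b s) := by
  have hs0 : ∀ u, s u ≠ 0 := fun u => (h0 u).ne'
  have hF0 : ∀ u, F b (s u) ≠ 0 := fun u => (hF u).ne'
  have ht := contDiff_tilt hs hs0 hF0
  have cF := (contDiff_F_comp (b := b) hs hs0).continuous
  have c0 := (contDiff_pd hs 0).continuous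
  have c1 := (contDiff_pd hs 1).continuous
  have d0 := (contDiff_pd ht 0).continuous
  have d1 := (contDiff_pd ht 1).continuous
  have ct := ht.continuous
  have cs := hs.continuous
  have hs4 : ∀ u, s u ^ 4 ≠ 0 := fun u => pow_ne_zero 4 (hs0 u)
  have hF2 : ∀ u, 2 * F b (s u) ≠ 0 := fun u => mul_ne_zero two_ne_zero (hF0 u)
  have hsF : ∀ u, s u * F b (s u) ≠ 0 := fun u => mul_ne_zero (hs0 u) (hF0 u)
  have htn : ∀ u, 2 * (1 + tilt b s u) ≠ 0 := fun u => by
    have := tilt_nonneg (h0 u) (hF u)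
    positivity
  unfold remainder
  fun_prop (disch := assumption)

/-- The `2 s³` of the curvature integrand cancels against the volume term, whose lower endpoint
contributes `2 r_s³`; both divergences integrate to zero. -/
theorem Q_eq {b Px : ℝ} (hb : 0 < b) (hPx : 0 < Px) {s : (Fin 2 → ℝ) → ℝ}
    (hs : IsHeightFunction b Px s) :
    Q b Px s = Px * Py b * (2 * rs b ^ 3 - 1 / 2) +
      ∫ u in periodBox (periods b Px), remainder b s u := by
  have hP := periods_pos hb hPx
  have hrs := (rs_isGreatest hb).1.1
  have h0 : ∀ u, 0 < s u := fun u => hrs.trans (hs.gt_rs u)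
  have hF : ∀ u, 0 < F b (s u) := fun u => F_pos hb (hs.gt_rs u)
  have hs0 : ∀ u, s u ≠ 0 := fun u => (h0 u).ne'
  have hF0 : ∀ u, F b (s u) ≠ 0 := fun u => (hF u).ne'
  have hcs := hs.smooth.continuous
  have hp := contDiff_pd hs.smooth 0
  have hq : ContDiff ℝ ∞ (fun w => pd 1 s w / F b (s w)) :=
    (contDiff_pd hs.smooth 1).div (contDiff_F_comp hs.smooth hs0) hF0
  have hA := integral_pd_eq_zero hP hp (pd_periodic hs.per 0) 0
  have hD := integral_pd_eq_zero hP hq (fun w n => by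
    rw [pd_periodic hs.per 1, hs.per]) 1
  have cA := (contDiff_pd hp 0).continuous
  have cD := (contDiff_pd hq 1).continuous
  have cR := continuous_remainder hs.smooth h0 hF
  have iA := integrableOn_periodBox (P := periods b Px) cA
  have iD := integrableOn_periodBox (P := periods b Px) cD
  have iR := integrableOn_periodBox (P := periods b Px) cR
  have cS : Continuous fun u => 2 * s u ^ 3 := by fun_prop
  have iS := integrableOn_periodBox (P := periods b Px) cS
  have ic := fun c : ℝ => integrableOn_periodBox (P := periods b Px)
    (continuous_const (y := c))
  have h1 : ∀ u, meanCurvature (metric b) (graphMap s) (outwardNormal b s) u * s u *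
        √(firstForm (metric b) (graphMap s) u).det =
      2 * s u ^ 3 - 1 / 2 - pd 0 (pd 0 s) u - pd 1 (fun w => pd 1 s w / F b (s w)) u +
        remainder b s u := by
    intro u
    rw [meanCurvature_graph hs.smooth h0 hF, remainder]
    ring
  have hvol : ∀ u : Fin 2 → ℝ, ∀ x y, ∫ r in (rs b)..(s u), r * √(metric b ![r, x, y]).det =
      (s u ^ 3 - rs b ^ 3) / 3 := fun u x y => integral_volume hb (hs.gt_rs u) x y
  have hI1 := intervalIntegral_eq_periodBox hP (((((cS.sub (continuous_const (y := (1 / 2 : ℝ)))).sub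
    cA).sub cD).add cR))
  have cV : Continuous fun u => (s u ^ 3 - rs b ^ 3) / 3 := by fun_prop
  have hI2 := intervalIntegral_eq_periodBox hP cV
  have e0 : periods b Px 0 = Px := rfl
  have e1 : periods b Px 1 = Py b := rfl
  rw [e0, e1] at hI1 hI2
  unfold Q
  simp only [h1, hvol]
  rw [hI2]
  simp only [Pi.add_apply, Pi.sub_apply] at hI1
  rw [hI1]
  have s1 : ∫ u in periodBox (periods b Px), (2 * s u ^ 3 - 1 / 2 - pd 0 (pd 0 s) u -
      pd 1 (fun w => pd 1 s w / F b (s w)) u + remainder b s u) =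
      (∫ u in periodBox (periods b Px), 2 * s u ^ 3) - 1 / 2 * (Px * Py b) - 0 - 0 +
      ∫ u in periodBox (periods b Px), remainder b s u := by
    have j1 : IntegrableOn (fun u => 2 * s u ^ 3 - 1 / 2) (periodBox (periods b Px)) :=
      iS.sub (ic (1 / 2))
    have j2 : IntegrableOn (fun u => 2 * s u ^ 3 - 1 / 2 - pd 0 (pd 0 s) u)
      (periodBox (periods b Px)) := j1.sub iA
    have j3 : IntegrableOn (fun u => 2 * s u ^ 3 - 1 / 2 - pd 0 (pd 0 s) u -
      pd 1 (fun w => pd 1 s w / F b (s w)) u) (periodBox (periods b Px)) := j2.sub iD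
    rw [integral_add j3 iR, integral_sub j2 iD, integral_sub j1 iA,
      integral_sub iS (ic (1 / 2)), hA, hD, integral_const_periodBox hP, e0, e1]
  have s2 : 6 * ∫ u in periodBox (periods b Px), (s u ^ 3 - rs b ^ 3) / 3 =
      (∫ u in periodBox (periods b Px), 2 * s u ^ 3) - 2 * rs b ^ 3 * (Px * Py b) := by
    have hc := integral_const_periodBox hP (2 * rs b ^ 3)
    rw [e0, e1] at hc
    rw [← integral_const_mul, ← hc, ← integral_sub iS (ic _)]
    congr 1
    funext u
    ring
  rw [s1, s2]
  ring

/-- The remainder is controlled by the slope and by the gradient of the tilt. -/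
theorem abs_remainder_le {b : ℝ} (hb : 0 < b) {s : (Fin 2 → ℝ) → ℝ} {u : Fin 2 → ℝ}
    {l e g A : ℝ} (hs : 0 < s u) (hF : 0 < F b (s u)) (hsl : (s u)⁻¹ ≤ l) (hle : l ≤ e)
    (hFg : (F b (s u))⁻¹ ≤ g) (hp : |pd 0 s u| ≤ A) (hq : |pd 1 s u| ≤ A) :
    |remainder b s u| ≤ (A ^ 2 * (2 + (3 * e ^ 3 + 4 * b * e ^ 4) * g) + 2 * A ^ 2 * g) * l +
      (A * |pd 0 (tilt b s) u| + A * g * |pd 1 (tilt b s) u|) := by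
  have hx0 : 0 < (s u)⁻¹ := inv_pos.2 hs
  have hl0 : 0 < l := hx0.trans_le hsl
  have hy0 : 0 < (F b (s u))⁻¹ := inv_pos.2 hF
  have hA0 : 0 ≤ A := (abs_nonneg _).trans hp
  have hg0 : 0 < g := hy0.trans_le hFg
  have he0 : 0 < e := hl0.trans_le hle
  have hdF := dF_eq b hs.ne'
  rw [dF] at hdF
  have ht := tilt_nonneg hs hF
  have hpsq : pd 0 s u ^ 2 ≤ A ^ 2 := by rw [← sq_abs (pd 0 s u)]; gcongr
  have hqsq : pd 1 s u ^ 2 ≤ A ^ 2 := by rw [← sq_abs (pd 1 s u)]; gcongr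
  unfold remainder
  rw [hdF]
  set x := (s u)⁻¹ with hx
  set y := (F b (s u))⁻¹ with hy
  have hx4 : x ^ 4 ≤ e ^ 3 * l := by
    calc x ^ 4 = x ^ 3 * x := by ring
      _ ≤ e ^ 3 * l := by gcongr; exact hsl.trans hle
  have hx5 : x ^ 5 ≤ e ^ 4 * l := by
    calc x ^ 5 = x ^ 4 * x := by ring
      _ ≤ e ^ 4 * l := by gcongr; exact hsl.trans hle
  have e1 : pd 0 s u ^ 2 * (2 / s u + (3 * x ^ 4 + 4 * b * x ^ 5) / (2 * F b (s u))) +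
      2 * pd 1 s u ^ 2 / (s u * F b (s u)) =
      pd 0 s u ^ 2 * (2 * x + (3 * x ^ 4 + 4 * b * x ^ 5) * y / 2) +
      2 * pd 1 s u ^ 2 * (x * y) := by
    rw [hx, hy]; field_simp
  rw [e1]
  refine (abs_add_le _ _).trans (add_le_add ?_ ?_)
  · rw [abs_of_nonneg (by positivity)]
    calc _ ≤ A ^ 2 * (2 * l + (3 * (e ^ 3 * l) + 4 * b * (e ^ 4 * l)) * g / 2) +
          2 * A ^ 2 * (l * g) := by gcongr
      _ ≤ A ^ 2 * (2 * l + (3 * (e ^ 3 * l) + 4 * b * (e ^ 4 * l)) * g) +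
          2 * A ^ 2 * (l * g) := by
          gcongr
          exact half_le_self (by positivity)
      _ = _ := by ring
  -- Nonnegativity of the tilt makes the denominator at least 1, so it may be dropped.
  · have hden : 1 ≤ 2 * (1 + tilt b s u) := by linarith
    rw [abs_div, abs_of_pos (by linarith : 0 < 2 * (1 + tilt b s u))]
    refine (div_le_self (abs_nonneg _) hden).trans ((abs_add_le _ _).trans ?_)
    rw [abs_mul, abs_mul, div_eq_mul_inv, abs_mul, ← hy, abs_of_pos hy0]
    gcongr

/-! ### The error estimate and the limit -/

namespace IsNormalFlow

variable {b Px : ℝ} {φ : ℝ → (Fin 2 → ℝ) → Fin 3 → ℝ} {s : ℝ → (Fin 2 → ℝ) → ℝ}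

/-- Combines the pointwise `O(l)` bound on the slope terms with the `L¹` bound on the tilt gradient,
where `l = 1/(r_s + δ (t - 1))`. -/
theorem exists_Q_bound (hb : 0 < b) (hPx : 0 < Px) (h : IsNormalFlow b Px φ s) :
    ∃ δ M, 0 < δ ∧ ∀ t, 1 ≤ t →
      |Q b Px (s t) - Px * Py b * (2 * rs b ^ 3 - 1 / 2)| ≤ M * (rs b + δ * (t - 1))⁻¹ := by
  have hP := periods_pos hb hPx
  have hrs := (rs_isGreatest hb).1.1
  have hL := h.lagrangianFlow hb
  have hK : IsCompact (Icc 0 (periods b Px)) := isCompact_Icc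
  have hne : (Icc 0 (periods b Px)).Nonempty := nonempty_Icc.2 fun i => (hP i).le
  have hsub : periodBox (periods b Px) ⊆ Icc 0 (periods b Px) := fun u hu =>
    ⟨fun i => (hu i (mem_univ i)).1, fun i => (hu i (mem_univ i)).2.le⟩
  obtain ⟨δ, C, hδ, hC, B⟩ := hL.exists_flowBounds hb hK hne
  obtain ⟨J, hJ0, hJ⟩ := hL.exists_jacobian_bound hb hK hδ hC B
  obtain ⟨M, hM0, hM⟩ := hL.exists_tilt_bound hb hδ hC hJ0
  set e := (rs b)⁻¹ with he
  set g := (δ ^ 2)⁻¹ with hg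
  set A := C / δ with hA
  set V := periods b Px 0 * periods b Px 1 with hV
  refine ⟨δ, (A ^ 2 * (2 + (3 * e ^ 3 + 4 * b * e ^ 4) * g) + 2 * A ^ 2 * g) * V +
    (A * (2 * (J * M) * V) + A * g * (2 * (J * M) * V)), hδ, fun t ht => ?_⟩
  have ht0 : 0 < t := by linarith
  have hs := h.height t ht0.le
  have h0 : ∀ u, 0 < s t u := fun u => hrs.trans (hs.gt_rs u)
  have hF : ∀ u, 0 < F b (s t u) := fun u => F_pos hb (hs.gt_rs u)
  have hℓ : 0 < rs b + δ * (t - 1) := by nlinarith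
  set l := (rs b + δ * (t - 1))⁻¹ with hl
  have hl0 : 0 < l := inv_pos.2 hℓ
  have hle : l ≤ e := inv_anti₀ hrs (by nlinarith)
  rw [Q_eq hb hPx hs, add_sub_cancel_left]
  have hT := h.integral_abs_pd_tilt_le hb hPx ht0 hJ0.le (mul_pos hM0 hl0).le
    (fun u hu i => ⟨(hJ t ht u (hsub hu) i).1, (hJ t ht u (hsub hu) i).2.1⟩)
    (fun u hu i => hM t ht u (B t ht u (hsub hu)) i (hJ t ht u (hsub hu) i).2.2)
  -- Each torus point is reached by the flow from the fundamental box, so the Lagrangian bounds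
  -- `|α|, |γ| ≤ C` and `ρ ≥ δ` give slopes at most `C/δ` everywhere.
  have hslope : ∀ k, ∀ w, |pd k (s t) w| ≤ A := by
    intro k w
    obtain ⟨u, hu, n, hn⟩ := h.planar_surjective hb hPx ht0.le w
    rw [hn, pd_periodic hs.per]
    have Bu := B t ht u (hsub hu)
    have hρ : 0 < velR b φ (t, u) := hδ.trans_le Bu.ρ_ge
    have hprod : |pd k (s t) (planar φ t u)| * velR b φ (t, u) ≤ C := by
      rw [← abs_of_pos hρ, ← abs_mul]
      fin_cases k
      · have := Bu.α_le
        rw [h.velX_eq hb ht0, neg_mul, abs_neg] at this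
        exact this
      · have := Bu.γ_le
        rw [h.velY_eq hb ht0, neg_mul, abs_neg] at this
        exact this
    rw [hA, le_div_iff₀ hδ]
    exact (mul_le_mul_of_nonneg_left Bu.ρ_ge (abs_nonneg _)).trans hprod
  have hgrow : ∀ w, (s t w)⁻¹ ≤ l ∧ (F b (s t w))⁻¹ ≤ g := by
    intro w
    obtain ⟨u, hu, n, hn⟩ := h.planar_surjective hb hPx ht0.le w
    rw [hn, hs.per, ← h.radius_eq ht0.le]
    have Bu := B t ht u (hsub hu)
    exact ⟨inv_anti₀ hℓ Bu.growth, inv_anti₀ (by positivity) Bu.F_ge⟩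
  have hsm := contDiff_tilt (b := b) hs.smooth (fun u => (h0 u).ne') (fun u => (hF u).ne')
  have c0 : Continuous fun u => A * |pd 0 (tilt b (s t)) u| :=
    continuous_const.mul (contDiff_pd hsm 0).continuous.abs
  have c1 : Continuous fun u => A * g * |pd 1 (tilt b (s t)) u| :=
    continuous_const.mul (contDiff_pd hsm 1).continuous.abs
  have i0 := integrableOn_periodBox (P := periods b Px) c0
  have i1 := integrableOn_periodBox (P := periods b Px) c1
  have i01 : IntegrableOn (fun u => A * |pd 0 (tilt b (s t)) u| +
    A * g * |pd 1 (tilt b (s t)) u|) (periodBox (periods b Px)) := i0.add i1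
  set m := (A ^ 2 * (2 + (3 * e ^ 3 + 4 * b * e ^ 4) * g) + 2 * A ^ 2 * g) * l with hm
  have ic := integrableOn_periodBox (P := periods b Px) (continuous_const (y := m))
  have hA0 : 0 < A := div_pos hC hδ
  have hg0 : 0 < g := by positivity
  calc |∫ u in periodBox (periods b Px), remainder b (s t) u|
      ≤ ∫ u in periodBox (periods b Px), |remainder b (s t) u| := abs_integral_le_integral_abs
    _ ≤ ∫ u in periodBox (periods b Px), (m + (A * |pd 0 (tilt b (s t)) u| +
          A * g * |pd 1 (tilt b (s t)) u|)) := by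
        refine setIntegral_mono
          (integrableOn_periodBox (continuous_remainder hs.smooth h0 hF).abs)
          (ic.add i01) fun u => ?_
        exact abs_remainder_le hb (h0 u) (hF u) (hgrow u).1 hle (hgrow u).2 (hslope 0 u)
          (hslope 1 u)
    _ = m * V + (A * (∫ u in periodBox (periods b Px), |pd 0 (tilt b (s t)) u|) +
          A * g * ∫ u in periodBox (periods b Px), |pd 1 (tilt b (s t)) u|) := by
        rw [integral_add ic i01, integral_add i0 i1, integral_const_periodBox hP,
          integral_const_mul, integral_const_mul]
    _ ≤ m * V + (A * (2 * (J * (M * l)) * V) + A * g * (2 * (J * (M * l)) * V)) := by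
        gcongr
        · exact hT 0
        · exact hT 1
    _ = _ := by rw [hm]; ring

end IsNormalFlow

end

end AdSMelvin


theorem proposition5p1 (b Px : ℝ) (hb : 0 < b) (hPx : 0 < Px)
    (φ : ℝ → (Fin 2 → ℝ) → Fin 3 → ℝ) (s : ℝ → (Fin 2 → ℝ) → ℝ)
    (hφ : AdSMelvin.IsNormalFlow b Px φ s) :
    Tendsto (fun t => AdSMelvin.Q b Px (s t)) atTop
      (𝓝 (Px * AdSMelvin.Py b * (2 * AdSMelvin.rs b ^ 3 - 1 / 2))) := by
  obtain ⟨δ, M, hδ, hM⟩ := hφ.exists_Q_bound hb hPx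
  rw [tendsto_iff_norm_sub_tendsto_zero]
  have hlim : Tendsto (fun t => M * (AdSMelvin.rs b + δ * (t - 1))⁻¹) atTop (𝓝 0) := by
    have h1 : Tendsto (fun t : ℝ => AdSMelvin.rs b + δ * (t - 1)) atTop atTop :=
      tendsto_atTop_add_const_left _ _
        ((tendsto_atTop_add_const_right _ (-1) tendsto_id).const_mul_atTop hδ)
    simpa using (tendsto_inv_atTop_zero.comp h1).const_mul M
  refine squeeze_zero' (Eventually.of_forall fun t => norm_nonneg _) ?_ hlim
  filter_upwards [eventually_ge_atTop 1] with t ht using hM t ht
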